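/- Let $N\ge1$, and let $\Omega_N\subset\mathbb C^{N\times N}$ be the set of normal matrices. For $h>0$ let $d\gamma_h(z)=(\pi h)^{-1}e^{-|z|^2/h}\,dz$ on $\mathbb C$, and let $\mu_h$ be the image on $\Omega_N$ of $dU\otimes d\gamma_h(d_1)\cdots d\gamma_h(d_N)$ under $(U,d)\mapsto U^*\operatorname{diag}(d_1,\dots,d_N)\,U$, where $dU$ is the normalized Haar measure on the unitary group $U(N)$. Let $\mathcal H_h$ be the closed subspace of $L^2_{\mathbb C^N}(\Omega_N,\mu_h)$ spanned by the functions $Z\mapsto Z^k\chi$ ($k\ge0$, $\chi\in\mathbb C^N$); its reproducing kernel is $K_h(X,Y)=\sum_{k\ge0}X^kY^{*k}/(k!\,h^k)$, and $K_{X,\chi}:=K_h(\cdot,X)\chi\in\mathcal H_h$. For $\phi:\Omega_N\to\mathbb C^{N\times N}$ the Toeplitz operator is $T_\phi g=P(\phi g)$, where $P:L^2\to\mathcal H_h$ is the orthogonal projection, with domain $\{g\in\mathcal H_h:\phi g\in L^2\}$ (which is all of $\mathcal H_h$ if $\phi$ is bounded and measurable). The Berezin transform of an operator $T$ on $\mathcal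 H_h$ is $$\widetilde T(X)=K_h(X,X)^{-1/2}\,B(X)\,K_h(X,X)^{-1/2},\qquad \chi'^*B(X)\chi=\langle TK_{X,\chi},K_{X,\chi'}\rangle,$$ defined at those $X\in\Omega_N$ for which all $K_{X,\chi}$ lie in the domain of $T$. Likewise, on the Segal–Bargmann space $L^2_{\rm hol}(\mathbb C,\gamma_h)$ with kernel functions $K_x(z)=e^{z\bar x/h}$, put $T_fg=P(fg)$ with domain $\{g: fg\in L^2(\gamma_h)\}$, and $\widetilde{T_f}(x)=\langle T_fK_x,K_x\rangle/\|K_x\|^2$. Let $f:\mathbb C\to\mathbb C$ be continuous, and let $\phi=f^\#$ be the associated spectral function, i.e. $f^\#(U\operatorname{diag}(d_j)U^*)=U\operatorname{diag}(f(d_j))U^*$ for $U\in U(N)$, $d\in\mathbb C^N$. (1) If $h>0$, $x\in\mathbb C$ and $K_x$ is in the domain of $T_f$ (i.e. $fK_x\in L^2(\gamma_h)$), then $K_{xI,\chi}$ is in the domain of $T_\phi$ for all $\chi\in\mathbb C^N$, and $$\widetilde{T_\phi}(xI)=\widetilde{T_f}(x)\cdot I .$$ (2) Suppose $f\in L^2(\mathbb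 C,\gamma_{h_0})$ for some $h_0>0$ (which holds for all $h_0$ if $f$ is bounded). Then for $0<h<h_0$ all $K_x$, $x\in\mathbb C$, are in the domain of $T_f$ and all $K_{X,\chi}$, $X\in\Omega_N$, $\chi\in\mathbb C^N$, are in the domain of $T_\phi$, and $$\lim_{h\to0}\|\widetilde{T_\phi}\|_\infty=\lim_{h\to0}\|T_\phi\|=\|\phi\|_\infty ,$$ where $\|\psi\|_\infty=\sup_{X\in\Omega_N}\|\psi(X)\|_{\mathbb C^N\to\mathbb C^N}$, $\|T_\phi\|=\sup\{\|T_\phi g\|: g\in\operatorname{dom}T_\phi,\ \|g\|\le1\}$, and all quantities take values in $[0,\infty]$. -/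

import Mathlib

open MeasureTheory Filter Topology
open scoped ENNReal Matrix InnerProductSpace

noncomputable section

namespace BerezinToeplitz

/-! ### Toeplitz operators, operator norms, Berezin pairing -/

section General

variable {Ω : Type*} [MeasurableSpace Ω] {μ : Measure Ω}
variable {V : Type*} [NormedAddCommGroup V] [InnerProductSpace ℂ V]

theorem symbol_zero (φ : Ω → V →L[ℂ] V) :
    (fun z => φ z ((0 : Lp V 2 μ) z)) =ᵐ[μ] 0 := by
  filter_upwards [Lp.coeFn_zero V 2 μ] with z hz
  rw [hz]; simp

theorem symbol_add (φ : Ω → V →L[ℂ] V) (a b : Lp V 2 μ) :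
    (fun z => φ z ((a + b) z)) =ᵐ[μ] (fun z => φ z (a z)) + fun z => φ z (b z) := by
  filter_upwards [Lp.coeFn_add a b] with z hz
  rw [hz]; simp

theorem symbol_smul (φ : Ω → V →L[ℂ] V) (c : ℂ) (a : Lp V 2 μ) :
    (fun z => φ z ((c • a) z)) =ᵐ[μ] c • fun z => φ z (a z) := by
  filter_upwards [Lp.coeFn_smul c a] with z hz
  rw [hz]; simp

/-- The subspace of those `g` in `L²(Ω, μ; V)` with `φ g` in `L²(Ω, μ; V)`. -/
def symbolDomain (φ : Ω → V →L[ℂ] V) : Submodule ℂ (Lp V 2 μ) where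
  carrier := {g | MemLp (fun z => φ z (g z)) 2 μ}
  zero_mem' := MemLp.zero.ae_eq (symbol_zero φ).symm
  add_mem' {a b} ha hb := (MemLp.add ha hb).ae_eq (symbol_add φ a b).symm
  smul_mem' c a ha := (MemLp.const_smul ha c).ae_eq (symbol_smul φ c a).symm

theorem symbolDomain_memLp {φ : Ω → V →L[ℂ] V} {g : Lp V 2 μ} (hg : g ∈ symbolDomain φ) :
    MemLp (fun z => φ z (g z)) 2 μ := hg

/-- Multiplication by the symbol `φ`, from its natural domain to `L²(Ω, μ; V)`. -/
def symbolMul (φ : Ω → V →L[ℂ] V) : symbolDomain (μ := μ) φ →ₗ[ℂ] Lp V 2 μ where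
  toFun g := MemLp.toLp (fun z => φ z ((g : Lp V 2 μ) z)) (symbolDomain_memLp g.2)
  map_add' a b := by
    rw [← MemLp.toLp_add, MemLp.toLp_eq_toLp_iff]
    exact symbol_add φ (a : Lp V 2 μ) b
  map_smul' c a := by
    rw [RingHom.id_apply, ← MemLp.toLp_const_smul, MemLp.toLp_eq_toLp_iff]
    exact symbol_smul φ c (a : Lp V 2 μ)

/-- The Toeplitz operator `T_φ g = P (φ g)` on a closed subspace `H` of `L²(Ω, μ; V)`, where `P` is
the orthogonal projection onto `H`, on its maximal domain `{g ∈ H : φ g ∈ L²}` (which is all of `H`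
when `φ` is measurable and bounded). -/
def toeplitz (H : Submodule ℂ (Lp V 2 μ)) [H.HasOrthogonalProjection] (φ : Ω → V →L[ℂ] V) :
    H →ₗ.[ℂ] H where
  domain := (symbolDomain φ).comap H.subtype
  toFun := H.orthogonalProjectionOnto.toLinearMap ∘ₗ symbolMul φ ∘ₗ
    LinearMap.restrict (p := (symbolDomain φ).comap H.subtype) (q := symbolDomain φ)
      H.subtype fun _ hg => hg

variable {H : Type*} [NormedAddCommGroup H] [InnerProductSpace ℂ H]

/-- The operator norm (possibly `∞`) of a linear operator defined on a subspace of `H`. -/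
def opENorm (T : H →ₗ.[ℂ] H) : ℝ≥0∞ := ⨆ (g : T.domain) (_ : ‖g‖ ≤ 1), ‖T g‖ₑ

open Classical in
/-- The scalar product `⟨T u, v⟩`, linear in `u` and conjugate-linear in `v` (with the value `0` if
`u` is not in the domain of `T`). -/
def pairing (T : H →ₗ.[ℂ] H) (u v : H) : ℂ :=
  if hu : u ∈ T.domain then ⟪v, T ⟨u, hu⟩⟫_ℂ else 0

end General

/-- The range of the Planck constant: positive reals. -/
abbrev Planck : Type := {h : ℝ // 0 < h}

/-- The filter `h → 0` on positive reals. -/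
def hZero : Filter Planck := comap Subtype.val (𝓝 (0 : ℝ))

/-! ### The scalar Segal–Bargmann space -/

/-- The Gaussian probability measure `(π h)⁻¹ exp (-|z|² / h) dz` on `ℂ`. -/
def gaussian (h : Planck) : Measure ℂ :=
  volume.withDensity fun z => ENNReal.ofReal ((Real.pi * h)⁻¹ * Real.exp (-‖z‖ ^ 2 / h))

/-- The Segal–Bargmann space `L²_hol(ℂ, μ_h)`. -/
def segalBargmann (h : Planck) : Submodule ℂ (Lp ℂ 2 (gaussian h)) where
  carrier := {g | ∃ G : ℂ → ℂ, Differentiable ℂ G ∧ g =ᵐ[gaussian h] G}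
  zero_mem' := ⟨0, differentiable_const 0, Lp.coeFn_zero _ _ _⟩
  add_mem' := by
    rintro a b ⟨A, hA, hA'⟩ ⟨B, hB, hB'⟩
    exact ⟨A + B, hA.add hB, (Lp.coeFn_add a b).trans (hA'.add hB')⟩
  smul_mem' := by
    rintro c a ⟨A, hA, hA'⟩
    exact ⟨c • A, hA.const_smul c, (Lp.coeFn_smul c a).trans (hA'.const_smul c)⟩

/-- The reproducing kernel section `K_h(·, y)`, `K_h(z, y) = exp (z ȳ / h)`. -/
def scalarKernel (h : Planck) (y z : ℂ) : ℂ := Complex.exp (z * starRingEnd ℂ y / (h : ℝ))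


theorem measurable_density (h : Planck) : Measurable fun z : ℂ =>
    ENNReal.ofReal ((Real.pi * h)⁻¹ * Real.exp (-‖z‖ ^ 2 / h)) := by fun_prop

instance (h : Planck) : SigmaFinite (gaussian h) := by
  unfold gaussian; infer_instance

theorem integrable_exp_norm (h : Planck) (a : ℝ) :
    Integrable (fun z : ℂ => Real.exp (a * ‖z‖)) (gaussian h) := by
  have hh : (0 : ℝ) < h := h.2
  unfold gaussian
  rw [integrable_withDensity_iff (measurable_density h) (by simp)]
  have h1 := (GaussianFourier.integrable_cexp_neg_mul_sq_norm_add (V := ℂ)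
    (b := ((1 / (2 * h) : ℝ) : ℂ)) (by rw [Complex.ofReal_re]; positivity) 0 0).norm
  refine (h1.const_mul ((Real.pi * h)⁻¹ * Real.exp (a ^ 2 * h / 2))).mono'
    (by fun_prop) (ae_of_all _ fun z => ?_)
  rw [Real.norm_of_nonneg (by positivity), ENNReal.toReal_ofReal (by positivity)]
  have e : ‖Complex.exp (-((1 / (2 * h) : ℝ) : ℂ) * (‖z‖ : ℂ) ^ 2 + 0 * ((inner ℝ (0 : ℂ) z : ℝ) : ℂ))‖
      = Real.exp (-(1 / (2 * h)) * ‖z‖ ^ 2) := by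
    rw [Complex.norm_exp]; norm_cast; simp
  rw [e]
  have : a * ‖z‖ + -‖z‖ ^ 2 / h ≤ a ^ 2 * h / 2 + -(1 / (2 * h)) * ‖z‖ ^ 2 := by
    have : 0 ≤ (a * h - ‖z‖) ^ 2 / (2 * h) := by positivity
    have e2 : (a * h - ‖z‖) ^ 2 / (2 * h)
        = a ^ 2 * h / 2 - a * ‖z‖ + ‖z‖ ^ 2 / (2 * h) := by field_simp; ring
    have e3 : ‖z‖ ^ 2 / (h : ℝ) = ‖z‖ ^ 2 / (2 * h) + ‖z‖ ^ 2 / (2 * h) := by field_simp; ring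
    have e4 : -‖z‖ ^ 2 / (h : ℝ) = - (‖z‖ ^ 2 / h) := by ring
    have e5 : -(1 / (2 * (h : ℝ))) * ‖z‖ ^ 2 = - (‖z‖ ^ 2 / (2 * h)) := by ring
    rw [e4, e5]; linarith
  calc _ = (Real.pi * h)⁻¹ * Real.exp (a * ‖z‖ + -‖z‖ ^ 2 / h) := by rw [Real.exp_add]; ring
    _ ≤ (Real.pi * h)⁻¹ * Real.exp (a ^ 2 * h / 2 + -(1 / (2 * h)) * ‖z‖ ^ 2) := by gcongr
    _ = _ := by rw [Real.exp_add]; ring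

theorem differentiable_scalarKernel (h : Planck) (y : ℂ) :
    Differentiable ℂ (scalarKernel h y) := by
  unfold scalarKernel; fun_prop

theorem memLp_scalarKernel (h : Planck) (y : ℂ) : MemLp (scalarKernel h y) 2 (gaussian h) := by
  have hh : (0 : ℝ) < h := h.2
  rw [memLp_two_iff_integrable_sq_norm
    (differentiable_scalarKernel h y).continuous.aestronglyMeasurable]
  refine (integrable_exp_norm h (2 * ‖y‖ / h)).mono'
    (((differentiable_scalarKernel h y).continuous.norm.pow 2).aestronglyMeasurable)
    (ae_of_all _ fun z => ?_)
  rw [Real.norm_of_nonneg (by positivity), scalarKernel, Complex.norm_exp, ← Real.exp_nat_mul]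
  have : (z * starRingEnd ℂ y / ((h : ℝ) : ℂ)).re ≤ ‖z‖ * ‖y‖ / h := by
    refine (Complex.re_le_norm _).trans_eq ?_
    simp [abs_of_pos hh]
  refine Real.exp_le_exp.2 ?_
  calc _ ≤ (2 : ℕ) * (‖z‖ * ‖y‖ / h) := by gcongr
    _ = _ := by push_cast; ring

theorem enorm_sq_le_lintegral_ball (G : ℂ → ℂ) (hG : Differentiable ℂ G) (z : ℂ) :
    ENNReal.ofReal Real.pi * ‖G z‖ₑ ^ 2 ≤ ∫⁻ w in Metric.ball z 1, ‖G w‖ₑ ^ 2 := by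
  have hc : Continuous fun w => ‖G w‖ₑ ^ 2 := by have := hG.continuous; fun_prop
  have circ : ∀ r : ℝ, ENNReal.ofReal (2 * Real.pi) * ‖G z‖ₑ ^ 2 ≤
      ∫⁻ t in Set.Ioo (-Real.pi) Real.pi, ‖G (z + Complex.polarCoord.symm (r, t))‖ₑ ^ 2 := by
    intro r
    have h1 : Real.circleAverage (fun w => G w ^ 2) z r = G z ^ 2 :=
      DiffContOnCl.circleAverage (hG.pow 2).diffContOnCl
    have h2 : (∫ t in (-Real.pi)..Real.pi, G (circleMap z r t) ^ 2) = (2 * Real.pi : ℝ) • G z ^ 2 := by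
      rw [← h1, Real.circleAverage_def, smul_smul, mul_inv_cancel₀ (by positivity), one_smul]
      have hp : Function.Periodic (fun t => G (circleMap z r t) ^ 2) (2 * Real.pi) :=
        (periodic_circleMap z r).comp (fun w => G w ^ 2)
      have := hp.intervalIntegral_add_eq (-Real.pi) 0
      simpa [two_mul] using this
    have h3 : ENNReal.ofReal (2 * Real.pi) * ‖G z‖ₑ ^ 2 = ‖(2 * Real.pi : ℝ) • G z ^ 2‖ₑ := by
      rw [enorm_smul, enorm_pow, Real.enorm_eq_ofReal (by positivity)]
    rw [h3, ← h2, intervalIntegral.integral_of_le (by linarith [Real.pi_pos]),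
      integral_Ioc_eq_integral_Ioo]
    refine (enorm_integral_le_lintegral_enorm _).trans_eq ?_
    refine lintegral_congr fun t => ?_
    rw [enorm_pow, Complex.polarCoord_symm_apply, circleMap, Complex.exp_mul_I]
    simp
  have h4 : (∫⁻ w in Metric.ball z 1, ‖G w‖ₑ ^ 2) =
      ∫⁻ w, (Metric.ball (0 : ℂ) 1).indicator (fun w => ‖G (z + w)‖ₑ ^ 2) w := by
    rw [← lintegral_indicator measurableSet_ball,
      ← lintegral_add_left_eq_self _ z]
    refine lintegral_congr fun w => ?_
    simp [Set.indicator]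
  rw [h4, ← Complex.lintegral_comp_polarCoord_symm, polarCoord_target, Measure.volume_eq_prod,
    ← Measure.prod_restrict, lintegral_prod _ (by
      have hm : Measurable ((Metric.ball (0 : ℂ) 1).indicator fun w => ‖G (z + w)‖ₑ ^ 2) :=
        (hc.comp (continuous_const.add continuous_id)).measurable.indicator measurableSet_ball
      have hp : Measurable fun p : ℝ × ℝ => Complex.polarCoord.symm p := by
        have : (fun p : ℝ × ℝ => Complex.polarCoord.symm p) = fun p : ℝ × ℝ =>
          (p.1 : ℂ) * (Real.cos p.2 + Real.sin p.2 * Complex.I) := by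
          funext p; rw [Complex.polarCoord_symm_apply]
        rw [this]; fun_prop
      have hmp := hm.comp hp
      exact AEMeasurable.mul (by fun_prop) hmp.aemeasurable)]
  have h5 : ENNReal.ofReal Real.pi = (∫⁻ r in Set.Ioo (0 : ℝ) 1, ENNReal.ofReal r) *
      ENNReal.ofReal (2 * Real.pi) := by
    rw [← ofReal_integral_eq_lintegral_ofReal, ← integral_Ioc_eq_integral_Ioo,
      ← intervalIntegral.integral_of_le zero_le_one, integral_id, ← ENNReal.ofReal_mul (by norm_num)]
    · congr 1; ring
    · exact (continuous_id.integrableOn_Icc (a := (0 : ℝ)) (b := 1)).mono_set Set.Ioo_subset_Icc_self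
    · exact (ae_restrict_iff' measurableSet_Ioo).2 (ae_of_all _ fun r hr => hr.1.le)
  rw [h5, mul_assoc, ← lintegral_mul_const _ (by fun_prop)]
  refine (setLIntegral_mono' measurableSet_Ioo fun r hr => ?_).trans
    (lintegral_mono_set (fun r hr => hr.1))
  rw [show (∫⁻ y in Set.Ioo (-Real.pi) Real.pi, ENNReal.ofReal (r, y).1 •
      (Metric.ball (0 : ℂ) 1).indicator (fun w => ‖G (z + w)‖ₑ ^ 2)
        (Complex.polarCoord.symm (r, y))) =
      ∫⁻ y in Set.Ioo (-Real.pi) Real.pi, ENNReal.ofReal r *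
        ‖G (z + Complex.polarCoord.symm (r, y))‖ₑ ^ 2 from by
    refine lintegral_congr fun t => ?_
    rw [Set.indicator_of_mem, smul_eq_mul]
    simp [abs_of_pos hr.1, hr.2]]
  rw [lintegral_const_mul']
  · gcongr; exact circ r
  · simp

theorem exists_norm_le (h : Planck) (R : ℝ) : ∃ C : ℝ, ∀ g : Lp ℂ 2 (gaussian h), ∀ G : ℂ → ℂ,
    Differentiable ℂ G → g =ᵐ[gaussian h] G → ∀ z : ℂ, ‖z‖ ≤ R → ‖G z‖ ≤ C * ‖g‖ := by
  have hh : (0 : ℝ) < h := h.2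
  set c : ℝ := Real.pi * ((Real.pi * h)⁻¹ * Real.exp (-(R + 1) ^ 2 / h)) with hc
  have hc0 : 0 < c := by positivity
  refine ⟨(√c)⁻¹, fun g G hG hg z hz => ?_⟩
  have h1 : ENNReal.ofReal c * ‖G z‖ₑ ^ 2 ≤ ∫⁻ w, ‖G w‖ₑ ^ 2 ∂(gaussian h) := by
    rw [gaussian, lintegral_withDensity_eq_lintegral_mul _ (measurable_density h)
      (by have := hG.continuous; fun_prop), hc, ENNReal.ofReal_mul (by positivity), mul_comm
        (ENNReal.ofReal Real.pi), mul_assoc]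
    calc _ ≤ ENNReal.ofReal ((Real.pi * h)⁻¹ * Real.exp (-(R + 1) ^ 2 / h)) *
          ∫⁻ w in Metric.ball z 1, ‖G w‖ₑ ^ 2 := by
            gcongr; exact enorm_sq_le_lintegral_ball G hG z
      _ = ∫⁻ w in Metric.ball z 1, ENNReal.ofReal
          ((Real.pi * h)⁻¹ * Real.exp (-(R + 1) ^ 2 / h)) * ‖G w‖ₑ ^ 2 := by
            rw [lintegral_const_mul' _ _ (by simp)]
      _ ≤ ∫⁻ w in Metric.ball z 1, ENNReal.ofReal
          ((Real.pi * h)⁻¹ * Real.exp (-‖w‖ ^ 2 / h)) * ‖G w‖ₑ ^ 2 := by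
            refine setLIntegral_mono' measurableSet_ball fun w hw => ?_
            have : ‖w‖ ≤ R + 1 := by
              have h2 : ‖w - z‖ < 1 := by simpa [dist_eq_norm] using hw
              have := norm_add_le (w - z) z
              rw [sub_add_cancel] at this
              linarith
            gcongr
      _ ≤ _ := setLIntegral_le_lintegral _ _
  have h2 : ∫⁻ w, ‖G w‖ₑ ^ 2 ∂(gaussian h) = ENNReal.ofReal (‖g‖ ^ 2) := by
    rw [Lp.norm_def, ENNReal.ofReal_pow ENNReal.toReal_nonneg, ENNReal.ofReal_toReal
      (Lp.eLpNorm_ne_top g), eLpNorm_congr_ae hg,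
      eLpNorm_eq_lintegral_rpow_enorm_toReal (by simp) (by simp)]
    rw [← ENNReal.rpow_natCast, ← ENNReal.rpow_mul]
    simp
  rw [h2, ← ofReal_norm, ← ENNReal.ofReal_pow (norm_nonneg _), ← ENNReal.ofReal_mul hc0.le,
    ENNReal.ofReal_le_ofReal_iff (by positivity)] at h1
  have h3 : (√c * ‖G z‖) ^ 2 ≤ ‖g‖ ^ 2 := by rwa [mul_pow, Real.sq_sqrt hc0.le]
  have h4 := (pow_le_pow_iff_left₀ (by positivity) (by positivity) two_ne_zero).1 h3
  rw [inv_mul_eq_div, le_div_iff₀ (by positivity)]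
  linarith

theorem isClosed_segalBargmann (h : Planck) :
    IsClosed (segalBargmann h : Set (Lp ℂ 2 (gaussian h))) := by
  refine IsSeqClosed.isClosed fun g g₀ hg hlim => ?_
  choose G hG hGg using hg
  have unif : ∀ R : ℝ, UniformCauchySeqOn G atTop (Metric.closedBall 0 R) := by
    intro R
    obtain ⟨C, hC⟩ := exists_norm_le h R
    rw [Metric.uniformCauchySeqOn_iff]
    intro ε hε
    have hcau := hlim.cauchySeq
    obtain ⟨n₀, hn₀⟩ := Metric.cauchySeq_iff.1 hcau (ε / (|C| + 1)) (by positivity)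
    refine ⟨n₀, fun m hm n hn z hz => ?_⟩
    have h1 := hC (g m - g n) (G m - G n) ((hG m).sub (hG n))
      ((Lp.coeFn_sub _ _).trans ((hGg m).sub (hGg n))) z (by simpa using hz)
    have h2 := hn₀ m hm n hn
    rw [dist_eq_norm] at h2 ⊢
    rw [Pi.sub_apply] at h1
    calc _ ≤ C * ‖g m - g n‖ := h1
      _ ≤ (|C| + 1) * ‖g m - g n‖ := by gcongr; linarith [le_abs_self C]
      _ < (|C| + 1) * (ε / (|C| + 1)) := by gcongr
      _ = ε := by field_simp
  have pt : ∀ z, ∃ l, Tendsto (fun n => G n z) atTop (𝓝 l) := fun z =>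
    cauchySeq_tendsto_of_complete ((unif ‖z‖).cauchySeq (x := z) (by simp))
  choose L hL using pt
  have hloc : TendstoLocallyUniformlyOn G L atTop Set.univ := by
    rw [tendstoLocallyUniformlyOn_iff_forall_isCompact isOpen_univ]
    intro K _ hK
    obtain ⟨R, hR⟩ := hK.isBounded.subset_closedBall 0
    exact ((unif R).tendstoUniformlyOn_of_tendsto fun z _ => hL z).mono hR
  have hdiff : Differentiable ℂ L := by
    rw [← differentiableOn_univ]
    exact hloc.differentiableOn (Eventually.of_forall fun n => (hG n).differentiableOn) isOpen_univ
  refine ⟨L, hdiff, ?_⟩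
  have hm : TendstoInMeasure (gaussian h) (fun n => (g n : ℂ → ℂ)) atTop g₀ :=
    tendstoInMeasure_of_tendsto_Lp hlim
  obtain ⟨ns, hns, hae⟩ := hm.exists_seq_tendsto_ae
  filter_upwards [hae, ae_all_iff.2 hGg] with z hz hz'
  refine tendsto_nhds_unique hz ?_
  simp only [hz']
  exact (hL z).comp hns.tendsto_atTop

instance (h : Planck) : CompleteSpace (segalBargmann h) :=
  (isClosed_segalBargmann h).completeSpace_coe

/-- The kernel section `K_h(·, y)` as an element of the Segal–Bargmann space. -/
def scalarKernelVec (h : Planck) (y : ℂ) : segalBargmann h :=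
  ⟨(memLp_scalarKernel h y).toLp _,
    ⟨scalarKernel h y, differentiable_scalarKernel h y, MemLp.coeFn_toLp _⟩⟩

/-- The scalar Toeplitz operator `T_f` on the Segal–Bargmann space. -/
def scalarToeplitz (h : Planck) (f : ℂ → ℂ) : segalBargmann h →ₗ.[ℂ] segalBargmann h :=
  toeplitz (segalBargmann h) fun z => f z • ContinuousLinearMap.id ℂ ℂ

/-- The scalar Berezin transform `y ↦ ⟨T k_y, k_y⟩`, where `k_y = K_h(·, y) / ‖K_h(·, y)‖`. -/
def scalarBerezin {h : Planck} (T : segalBargmann h →ₗ.[ℂ] segalBargmann h) (y : ℂ) : ℂ :=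
  let k : segalBargmann h := ((‖scalarKernelVec h y‖⁻¹ : ℝ) : ℂ) • scalarKernelVec h y
  pairing T k k

/-! ### Normal matrices -/

section NormalMatrices

/-- The inverse square root of a positive definite matrix. -/
def invSqrt {N : ℕ} (A : Matrix (Fin N) (Fin N) ℂ) : Matrix (Fin N) (Fin N) ℂ :=
  cfc (fun t : ℝ => (√t)⁻¹) A

open scoped Matrix.Norms.L2Operator

instance (N : ℕ) : MeasurableSpace (Matrix (Fin N) (Fin N) ℂ) := borel _

instance (N : ℕ) : BorelSpace (Matrix (Fin N) (Fin N) ℂ) := ⟨rfl⟩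

instance (N : ℕ) : SecondCountableTopology (Matrix (Fin N) (Fin N) ℂ) :=
  inferInstanceAs (SecondCountableTopology (Fin N → Fin N → ℂ))

instance (N : ℕ) : CompactSpace (Matrix.unitaryGroup (Fin N) ℂ) := by
  refine isCompact_iff_compactSpace.1 (Metric.isCompact_of_isClosed_isBounded isClosed_unitary ?_)
  refine isBounded_iff_forall_norm_le.2 ⟨1, fun U hU => ?_⟩
  have h1 := CStarRing.norm_mul_coe_unitary (1 : Matrix (Fin N) (Fin N) ℂ) ⟨U, hU⟩
  rw [one_mul] at h1
  rw [h1, ← Matrix.diagonal_one, Matrix.l2_opNorm_diagonal]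
  exact (pi_norm_le_iff_of_nonneg zero_le_one).2 fun i => by simp

/-- The domain of normal `N × N` matrices. -/
abbrev NormalMatrix (N : ℕ) : Type := {Z : Matrix (Fin N) (Fin N) ℂ // IsStarNormal Z}

/-- The normal matrix `U⋆ D U` with `D = diag(d_1, …, d_N)`. -/
def conjDiag {N : ℕ} (U : Matrix.unitaryGroup (Fin N) ℂ) (d : Fin N → ℂ) : NormalMatrix N :=
  ⟨star (U : Matrix (Fin N) (Fin N) ℂ) * Matrix.diagonal d * U, by
    have hU : (U : Matrix (Fin N) (Fin N) ℂ) * star (U : Matrix (Fin N) (Fin N) ℂ) = 1 :=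
      Unitary.coe_mul_star_self U
    constructor
    simp only [commute_iff_eq, star_mul, star_star]
    have e : ∀ A B : Matrix (Fin N) (Fin N) ℂ,
        star (U : Matrix (Fin N) (Fin N) ℂ) * A * U * (star (U : Matrix (Fin N) (Fin N) ℂ) * B * U)
          = star (U : Matrix (Fin N) (Fin N) ℂ) * (A * B) * U := by
      intro A B
      calc _ = star (U : Matrix (Fin N) (Fin N) ℂ) * A *
            ((U : Matrix (Fin N) (Fin N) ℂ) * star (U : Matrix (Fin N) (Fin N) ℂ)) * B * U := by
              simp only [mul_assoc]
        _ = _ := by rw [hU]; simp only [mul_assoc, one_mul]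
    rw [← mul_assoc (star (U : Matrix (Fin N) (Fin N) ℂ)) (star (Matrix.diagonal d)), e, e,
      Matrix.star_eq_conjTranspose (Matrix.diagonal d), Matrix.diagonal_conjTranspose,
      Matrix.diagonal_mul_diagonal, Matrix.diagonal_mul_diagonal]
    simp only [mul_comm]⟩

theorem continuous_conjDiag (N : ℕ) :
    Continuous fun p : Matrix.unitaryGroup (Fin N) ℂ × (Fin N → ℂ) => conjDiag p.1 p.2 := by
  refine Continuous.subtype_mk ?_ _
  have h1 : Continuous fun p : Matrix.unitaryGroup (Fin N) ℂ × (Fin N → ℂ) =>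
      (p.1 : Matrix (Fin N) (Fin N) ℂ) := continuous_subtype_val.comp continuous_fst
  exact (h1.star.mul (continuous_snd.matrix_diagonal)).mul h1

theorem norm_conjDiag {N : ℕ} (U : Matrix.unitaryGroup (Fin N) ℂ) (d : Fin N → ℂ) :
    ‖(conjDiag U d : Matrix (Fin N) (Fin N) ℂ)‖ = ‖d‖ := by
  have := CStarRing.norm_coe_unitary_mul (star U) (Matrix.diagonal d)
  rw [conjDiag, CStarRing.norm_mul_coe_unitary, ← Matrix.l2_opNorm_diagonal d, ← this]
  rfl

/-- The normalized Haar measure on the unitary group. -/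
def unitaryHaar (N : ℕ) : Measure (Matrix.unitaryGroup (Fin N) ℂ) := Measure.haarMeasure ⊤

/-- The measure `μ_h` on the normal matrices: the image of
`dU ⊗ (π h)^(-N) exp (-‖d‖² / h) dd` under `(U, d) ↦ U⋆ diag(d) U`. -/
def normalMeasure (N : ℕ) (h : Planck) : Measure (NormalMatrix N) :=
  ((unitaryHaar N).prod (Measure.pi fun _ : Fin N => gaussian h)).map fun p => conjDiag p.1 p.2

instance (N : ℕ) : IsFiniteMeasure (unitaryHaar N) := by
  unfold unitaryHaar; infer_instance

theorem integrable_exp_norm_normal (N : ℕ) (h : Planck) (a : ℝ) :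
    Integrable (fun Z : NormalMatrix N => Real.exp (a * ‖(Z : Matrix (Fin N) (Fin N) ℂ)‖))
      (normalMeasure N h) := by
  have hc : Continuous fun Z : NormalMatrix N =>
      Real.exp (a * ‖(Z : Matrix (Fin N) (Fin N) ℂ)‖) := by fun_prop
  unfold normalMeasure
  rw [integrable_map_measure hc.aestronglyMeasurable (continuous_conjDiag N).aemeasurable]
  have h1 : Integrable (fun d : Fin N → ℂ => ∏ i, Real.exp (|a| * ‖d i‖))
      (Measure.pi fun _ : Fin N => gaussian h) :=
    Integrable.fintype_prod fun i => integrable_exp_norm h |a|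
  refine (h1.comp_snd (unitaryHaar N)).mono'
    (hc.comp (continuous_conjDiag N)).aestronglyMeasurable (ae_of_all _ fun p => ?_)
  rw [Real.norm_of_nonneg (by simp [Real.exp_nonneg]), ← Real.exp_sum, Function.comp_apply,
    norm_conjDiag, ← Finset.mul_sum]
  refine Real.exp_le_exp.2 (mul_le_mul (le_abs_self a) ?_ (norm_nonneg _) (abs_nonneg _))
  exact (pi_norm_le_iff_of_nonneg (by positivity)).2 fun i =>
    Finset.single_le_sum (f := fun i => ‖p.2 i‖) (fun i _ => norm_nonneg _) (Finset.mem_univ i)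

theorem memLp_of_norm_le {N : ℕ} (h : Planck) {E : Type*} [NormedAddCommGroup E]
    {F : NormalMatrix N → E} (hF : AEStronglyMeasurable F (normalMeasure N h)) (C a : ℝ)
    (hle : ∀ Z : NormalMatrix N, ‖F Z‖ ≤ C * Real.exp (a * ‖(Z : Matrix (Fin N) (Fin N) ℂ)‖)) :
    MemLp F 2 (normalMeasure N h) := by
  rw [memLp_two_iff_integrable_sq_norm hF]
  refine ((integrable_exp_norm_normal N h (2 * a)).const_mul (C ^ 2)).mono'
    (hF.norm.pow 2) (ae_of_all _ fun Z => ?_)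
  rw [Real.norm_of_nonneg (by positivity)]
  calc _ ≤ (C * Real.exp (a * ‖(Z : Matrix (Fin N) (Fin N) ℂ)‖)) ^ 2 := by gcongr; exact hle Z
    _ = _ := by rw [mul_pow, ← Real.exp_nat_mul]; congr 2; push_cast; ring

theorem norm_matrix_pow_le {N : ℕ} (A : Matrix (Fin N) (Fin N) ℂ) (k : ℕ) :
    ‖A ^ k‖ ≤ ‖A‖ ^ k := by
  induction k with
  | zero =>
    rw [pow_zero, pow_zero, ← Matrix.diagonal_one, Matrix.l2_opNorm_diagonal]
    exact (pi_norm_le_iff_of_nonneg zero_le_one).2 fun i => by simp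
  | succ k ih =>
    rw [pow_succ, pow_succ]
    exact (norm_mul_le _ _).trans (by gcongr)

/-- The vector-valued function `Z ↦ Z ^ k χ`. -/
def monomial {N : ℕ} (k : ℕ) (χ : EuclideanSpace ℂ (Fin N)) (Z : NormalMatrix N) :
    EuclideanSpace ℂ (Fin N) :=
  Matrix.toEuclideanCLM (𝕜 := ℂ) ((Z : Matrix (Fin N) (Fin N) ℂ) ^ k) χ

theorem norm_toEuclideanCLM_le {N : ℕ} (A : Matrix (Fin N) (Fin N) ℂ)
    (χ : EuclideanSpace ℂ (Fin N)) : ‖Matrix.toEuclideanCLM (𝕜 := ℂ) A χ‖ ≤ ‖A‖ * ‖χ‖ :=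
  (Matrix.toEuclideanCLM (𝕜 := ℂ) A).le_opNorm χ

theorem continuous_toEuclideanCLM {N : ℕ} (χ : EuclideanSpace ℂ (Fin N)) :
    Continuous fun A : Matrix (Fin N) (Fin N) ℂ => Matrix.toEuclideanCLM (𝕜 := ℂ) A χ := by
  let L : Matrix (Fin N) (Fin N) ℂ →ₗ[ℂ] EuclideanSpace ℂ (Fin N) :=
    { toFun := fun A => Matrix.toEuclideanCLM (𝕜 := ℂ) A χ
      map_add' := fun A B => by simp
      map_smul' := fun c A => by simp }
  exact L.continuous_of_finiteDimensional

theorem memLp_monomial {N : ℕ} (h : Planck) (k : ℕ) (χ : EuclideanSpace ℂ (Fin N)) :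
    MemLp (monomial k χ) 2 (normalMeasure N h) := by
  refine memLp_of_norm_le h (Continuous.aestronglyMeasurable
    ((continuous_toEuclideanCLM χ).comp (continuous_subtype_val.pow k))) (k.factorial * ‖χ‖) 1
    fun Z => ?_
  refine (norm_toEuclideanCLM_le _ χ).trans ?_
  have h1 := norm_matrix_pow_le (Z : Matrix (Fin N) (Fin N) ℂ) k
  have h2 := Real.pow_div_factorial_le_exp ‖(Z : Matrix (Fin N) (Fin N) ℂ)‖ (norm_nonneg _) k
  rw [div_le_iff₀ (by positivity)] at h2
  calc _ ≤ ‖(Z : Matrix (Fin N) (Fin N) ℂ)‖ ^ k * ‖χ‖ := by gcongr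
    _ ≤ (Real.exp ‖(Z : Matrix (Fin N) (Fin N) ℂ)‖ * k.factorial) * ‖χ‖ := by gcongr
    _ = _ := by rw [one_mul]; ring

/-- The linear span of the functions `Z ↦ Z ^ k χ`. -/
def monomialSpan (N : ℕ) (h : Planck) :
    Submodule ℂ (Lp (EuclideanSpace ℂ (Fin N)) 2 (normalMeasure N h)) :=
  Submodule.span ℂ {g | ∃ k χ, g = (memLp_monomial h k χ).toLp (monomial k χ)}

/-- The Hilbert space `H_h` of `ℂ^N`-valued functions on the normal matrices: the closed subspace of
`L²` spanned by the functions `Z ↦ Z ^ k χ`. -/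
def normalSpace (N : ℕ) (h : Planck) :
    Submodule ℂ (Lp (EuclideanSpace ℂ (Fin N)) 2 (normalMeasure N h)) :=
  (monomialSpan N h).topologicalClosure

instance (N : ℕ) (h : Planck) : CompleteSpace (normalSpace N h) := by
  unfold normalSpace; infer_instance

/-- The `k`-th term `X ^ k Y⋆ ^ k / (k! h ^ k)` of the reproducing kernel. -/
def kernelTerm {N : ℕ} (h : Planck) (X Y : Matrix (Fin N) (Fin N) ℂ) (k : ℕ) :
    Matrix (Fin N) (Fin N) ℂ :=
  (((k.factorial : ℝ) * (h : ℝ) ^ k : ℝ) : ℂ)⁻¹ • (X ^ k * Yᴴ ^ k)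

/-- The matrix-valued reproducing kernel `K_h(X, Y) = ∑ₖ X ^ k Y⋆ ^ k / (k! h ^ k)`. -/
def normalKernel {N : ℕ} (h : Planck) (X Y : NormalMatrix N) : Matrix (Fin N) (Fin N) ℂ :=
  ∑' k : ℕ, kernelTerm h X.1 Y.1 k

theorem norm_kernelTerm_le {N : ℕ} (h : Planck) (X Y : Matrix (Fin N) (Fin N) ℂ) (k : ℕ) :
    ‖kernelTerm h X Y k‖ ≤ (‖X‖ * ‖Y‖ / h) ^ k / k.factorial := by
  have hh : (0 : ℝ) < h := h.2
  rw [kernelTerm, norm_smul, norm_inv, Complex.norm_real, Real.norm_of_nonneg (by positivity)]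
  have h1 : ‖X ^ k * Yᴴ ^ k‖ ≤ ‖X‖ ^ k * ‖Y‖ ^ k := by
    refine (norm_mul_le _ _).trans ?_
    have h3 := norm_matrix_pow_le Yᴴ k
    rw [Matrix.l2_opNorm_conjTranspose] at h3
    have h2 := norm_matrix_pow_le X k
    gcongr
  calc _ ≤ ((k.factorial : ℝ) * (h : ℝ) ^ k)⁻¹ * (‖X‖ ^ k * ‖Y‖ ^ k) := by gcongr
    _ = _ := by rw [div_pow, mul_pow]; field_simp

theorem summable_kernelTerm {N : ℕ} (h : Planck) (X Y : Matrix (Fin N) (Fin N) ℂ) :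
    Summable (kernelTerm h X Y) :=
  Summable.of_norm_bounded (Real.summable_pow_div_factorial _) (norm_kernelTerm_le h X Y)

theorem norm_kernel_sub_le {N : ℕ} (h : Planck) (X Y : NormalMatrix N) (n : ℕ) :
    ‖normalKernel h X Y - ∑ k ∈ Finset.range n, kernelTerm h X.1 Y.1 k‖ ≤
      (1 / 2) ^ n * Real.exp (2 * (‖X.1‖ * ‖Y.1‖ / h)) := by
  have hh : (0 : ℝ) < h := h.2
  set t : ℝ := ‖X.1‖ * ‖Y.1‖ / h with ht
  have ht0 : 0 ≤ t := by positivity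
  rw [normalKernel, ← (summable_kernelTerm h X.1 Y.1).sum_add_tsum_nat_add n, add_sub_cancel_left]
  have hs := (Real.summable_pow_div_factorial (2 * t))
  have hs2 := ((summable_nat_add_iff n).2 hs).mul_left ((1 / 2 : ℝ) ^ n)
  refine (tsum_of_norm_bounded hs2.hasSum fun k => ?_).trans ?_
  · refine (norm_kernelTerm_le h X.1 Y.1 (k + n)).trans ?_
    rw [← ht, ← mul_div_assoc]
    gcongr
    rw [mul_pow, ← mul_assoc]
    refine le_mul_of_one_le_left (by positivity) ?_
    rw [pow_add, mul_comm, mul_assoc, ← mul_pow]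
    norm_num
    exact one_le_pow₀ one_le_two
  · rw [tsum_mul_left, Real.exp_eq_exp_ℝ, NormedSpace.exp_eq_tsum_div]
    gcongr
    beta_reduce
    rw [← hs.sum_add_tsum_nat_add n]
    exact le_add_of_nonneg_left (Finset.sum_nonneg fun i _ => by positivity)

/-- The function `K_{Y, χ} = K_h(·, Y) χ`. -/
def kernelFun {N : ℕ} (h : Planck) (Y : NormalMatrix N) (χ : EuclideanSpace ℂ (Fin N))
    (X : NormalMatrix N) : EuclideanSpace ℂ (Fin N) :=
  Matrix.toEuclideanCLM (𝕜 := ℂ) (normalKernel h X Y) χ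

theorem continuous_kernelSum {N : ℕ} (h : Planck) (Y : NormalMatrix N) (n : ℕ) :
    Continuous fun X : NormalMatrix N => ∑ k ∈ Finset.range n, kernelTerm h X.1 Y.1 k := by
  unfold kernelTerm; fun_prop

theorem memLp_kernelFun {N : ℕ} (h : Planck) (Y : NormalMatrix N)
    (χ : EuclideanSpace ℂ (Fin N)) : MemLp (kernelFun h Y χ) 2 (normalMeasure N h) := by
  refine memLp_of_norm_le h ?_ ‖χ‖ (2 * (‖Y.1‖ / h)) fun X => ?_
  · refine aestronglyMeasurable_of_tendsto_ae atTop (f := fun (n : ℕ) (X : NormalMatrix N) =>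
      Matrix.toEuclideanCLM (𝕜 := ℂ) (∑ k ∈ Finset.range n, kernelTerm h X.1 Y.1 k) χ)
      (fun n => ((continuous_toEuclideanCLM χ).comp
        (continuous_kernelSum h Y n)).aestronglyMeasurable) (ae_of_all _ fun X => ?_)
    exact ((continuous_toEuclideanCLM χ).tendsto _).comp
      (summable_kernelTerm h X.1 Y.1).hasSum.tendsto_sum_nat
  · have h1 := norm_kernel_sub_le h X Y 0
    simp only [Finset.range_zero, Finset.sum_empty, sub_zero, pow_zero, one_mul] at h1
    refine (norm_toEuclideanCLM_le _ χ).trans ?_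
    rw [mul_comm ‖χ‖]
    gcongr
    exact h1.trans_eq (by congr 1; ring)

theorem exists_mem_monomialSpan {N : ℕ} (h : Planck) (Y : NormalMatrix N)
    (χ : EuclideanSpace ℂ (Fin N)) (n : ℕ) : ∃ g ∈ monomialSpan N h, g =ᵐ[normalMeasure N h]
      fun X => Matrix.toEuclideanCLM (𝕜 := ℂ) (∑ k ∈ Finset.range n, kernelTerm h X.1 Y.1 k) χ := by
  induction n with
  | zero => exact ⟨0, zero_mem _, (Lp.coeFn_zero _ _ _).trans (by simp; rfl)⟩
  | succ n ih =>
    obtain ⟨g, hg, hge⟩ := ih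
    set w := Matrix.toEuclideanCLM (𝕜 := ℂ) ((Y.1)ᴴ ^ n) χ with hw
    set c : ℂ := (((n.factorial : ℝ) * (h : ℝ) ^ n : ℝ) : ℂ)⁻¹ with hc
    refine ⟨g + c • (memLp_monomial h n w).toLp (monomial n w), add_mem hg
      (Submodule.smul_mem _ _ (Submodule.subset_span ⟨n, w, rfl⟩)), ?_⟩
    filter_upwards [Lp.coeFn_add g (c • (memLp_monomial h n w).toLp (monomial n w)),
      Lp.coeFn_smul c ((memLp_monomial h n w).toLp (monomial n w)),
      (memLp_monomial h n w).coeFn_toLp, hge] with X h1 h2 h3 h4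
    rw [h1, Pi.add_apply, h2, Pi.smul_apply, h3, h4, Finset.sum_range_succ, map_add,
      add_apply]
    congr 1
    rw [kernelTerm, map_smul, map_mul]
    rfl

theorem kernelFun_mem {N : ℕ} (h : Planck) (Y : NormalMatrix N)
    (χ : EuclideanSpace ℂ (Fin N)) :
    (memLp_kernelFun h Y χ).toLp (kernelFun h Y χ) ∈ normalSpace N h := by
  choose g hg hge using exists_mem_monomialSpan h Y χ
  set E : NormalMatrix N → ℝ := fun X => ‖χ‖ * Real.exp (2 * (‖Y.1‖ / h) * ‖X.1‖) with hE
  have hEm : MemLp E 2 (normalMeasure N h) := by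
    refine memLp_of_norm_le h (Continuous.aestronglyMeasurable (by fun_prop)) ‖χ‖
      (2 * (‖Y.1‖ / h)) fun X => ?_
    rw [Real.norm_of_nonneg (by positivity)]
  refine mem_closure_of_tendsto (f := g) (b := atTop) ?_ (Eventually.of_forall hg)
  rw [tendsto_iff_norm_sub_tendsto_zero]
  refine squeeze_zero (g := fun n : ℕ => (1 / 2 : ℝ) ^ n * ‖hEm.toLp E‖)
    (fun n => norm_nonneg _) (fun n => ?_) ?_
  · refine Lp.norm_le_mul_norm_of_ae_le_mul ?_
    filter_upwards [Lp.coeFn_sub (g n) ((memLp_kernelFun h Y χ).toLp (kernelFun h Y χ)), hge n,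
      (memLp_kernelFun h Y χ).coeFn_toLp, hEm.coeFn_toLp] with X h1 h2 h3 h4
    rw [h1, Pi.sub_apply, h2, h3, h4, kernelFun, norm_sub_rev, ← sub_apply,
      ← map_sub, Real.norm_of_nonneg (by positivity)]
    refine (norm_toEuclideanCLM_le _ χ).trans ?_
    calc _ ≤ ((1 / 2) ^ n * Real.exp (2 * (‖X.1‖ * ‖Y.1‖ / h))) * ‖χ‖ := by
          gcongr; exact norm_kernel_sub_le h X Y n
      _ = _ := by
          rw [hE, show 2 * (‖X.1‖ * ‖Y.1‖ / (h : ℝ)) = 2 * (‖Y.1‖ / h) * ‖X.1‖ by ring]; ring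
  · simpa using (tendsto_pow_atTop_nhds_zero_of_lt_one (by norm_num : (0 : ℝ) ≤ 1 / 2)
      (by norm_num)).mul_const ‖hEm.toLp E‖

/-- The function `K_{Y, χ} = K_h(·, Y) χ` as an element of `H_h`. -/
def kernelVec {N : ℕ} (h : Planck) (Y : NormalMatrix N) (χ : EuclideanSpace ℂ (Fin N)) :
    normalSpace N h :=
  ⟨(memLp_kernelFun h Y χ).toLp (kernelFun h Y χ), kernelFun_mem h Y χ⟩

/-- The Toeplitz operator `T_φ` on `H_h` with matrix-valued symbol `φ`. -/
def normalToeplitz {N : ℕ} (h : Planck) (φ : NormalMatrix N → Matrix (Fin N) (Fin N) ℂ) :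
    normalSpace N h →ₗ.[ℂ] normalSpace N h :=
  toeplitz (normalSpace N h) fun Z => Matrix.toEuclideanCLM (𝕜 := ℂ) (φ Z)

/-- The matrix `B` with `χ'⋆ B χ = ⟨T K_{X, χ}, K_{X, χ'}⟩` for all `χ, χ'`. -/
def preBerezin {N : ℕ} {h : Planck} (T : normalSpace N h →ₗ.[ℂ] normalSpace N h)
    (X : NormalMatrix N) : Matrix (Fin N) (Fin N) ℂ :=
  Matrix.of fun i j => pairing T (kernelVec h X (EuclideanSpace.single j 1))
    (kernelVec h X (EuclideanSpace.single i 1))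

/-- The matrix-valued Berezin transform `K(X, X)^(-1/2) B(X) K(X, X)^(-1/2)`. -/
def berezin {N : ℕ} {h : Planck} (T : normalSpace N h →ₗ.[ℂ] normalSpace N h)
    (X : NormalMatrix N) : Matrix (Fin N) (Fin N) ℂ :=
  invSqrt (normalKernel h X X) * preBerezin T X * invSqrt (normalKernel h X X)

/-- The supremum (possibly `∞`) over normal matrices of the operator norm on `ℂ^N` of a
matrix-valued function. -/
def supNorm {N : ℕ} (φ : NormalMatrix N → Matrix (Fin N) (Fin N) ℂ) : ℝ≥0∞ :=
  ⨆ Z, ‖Matrix.toEuclideanCLM (𝕜 := ℂ) (φ Z)‖ₑ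

/-- The normal matrix `x I`. -/
def scalarMatrix (N : ℕ) (x : ℂ) : NormalMatrix N := ⟨x • 1, ⟨by
  rw [star_smul, star_one]
  exact ((Commute.one_left _).smul_left _)⟩⟩

open Classical in
/-- The spectral function `f^#`: if `Z = U diag(d_j) U⋆` with `U` unitary, then
`f^#(Z) = U diag(f(d_j)) U⋆`. This does not depend on the chosen diagonalization. -/
def spectral {N : ℕ} (f : ℂ → ℂ) (Z : NormalMatrix N) : Matrix (Fin N) (Fin N) ℂ :=
  if hZ : ∃ p : Matrix.unitaryGroup (Fin N) ℂ × (Fin N → ℂ),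
      Z.1 = p.1 * Matrix.diagonal p.2 * star (p.1 : Matrix (Fin N) (Fin N) ℂ) then
    hZ.choose.1 * Matrix.diagonal (f ∘ hZ.choose.2) *
      star (hZ.choose.1 : Matrix (Fin N) (Fin N) ℂ)
  else 0

theorem spectral_eq {N : ℕ} (f : ℂ → ℂ) (Z : NormalMatrix N) (U : Matrix.unitaryGroup (Fin N) ℂ)
    (d : Fin N → ℂ)
    (hZ : Z.1 = U * Matrix.diagonal d * star (U : Matrix (Fin N) (Fin N) ℂ)) :
    spectral f Z = U * Matrix.diagonal (f ∘ d) * star (U : Matrix (Fin N) (Fin N) ℂ) := by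
  have hex : ∃ p : Matrix.unitaryGroup (Fin N) ℂ × (Fin N → ℂ),
      Z.1 = p.1 * Matrix.diagonal p.2 * star (p.1 : Matrix (Fin N) (Fin N) ℂ) := ⟨(U, d), hZ⟩
  rw [spectral, dif_pos hex]
  have hV := hex.choose_spec
  set V := hex.choose.1
  set e := hex.choose.2
  set u : Matrix (Fin N) (Fin N) ℂ := (U).1
  set v : Matrix (Fin N) (Fin N) ℂ := (V).1
  have hu : star u * u = 1 := Unitary.coe_star_mul_self U
  have hu' : u * star u = 1 := Unitary.coe_mul_star_self U
  have hv : star v * v = 1 := Unitary.coe_star_mul_self V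
  have hv' : v * star v = 1 := Unitary.coe_mul_star_self V
  set W := star v * u with hW
  have h1 : W * Matrix.diagonal d = Matrix.diagonal e * W := by
    have h2 : star v * (u * Matrix.diagonal d * star u) * u =
        star v * (v * Matrix.diagonal e * star v) * u := by rw [← hZ, hV]
    calc _ = star v * (u * Matrix.diagonal d * star u) * u := by
          simp only [hW, mul_assoc, hu, mul_one]
      _ = (star v * v) * Matrix.diagonal e * (star v * u) := by rw [h2]; simp only [mul_assoc]
      _ = _ := by rw [hv, one_mul]
  have h2 : W * Matrix.diagonal (f ∘ d) = Matrix.diagonal (f ∘ e) * W := by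
    ext i j
    have h3 := congrFun (congrFun h1 i) j
    rw [Matrix.mul_diagonal, Matrix.diagonal_mul] at h3 ⊢
    rcases eq_or_ne (W i j) 0 with h0 | h0
    · simp [h0]
    · have : d j = e i := by
        rw [mul_comm] at h3
        exact mul_right_cancel₀ h0 h3
      simp [this, mul_comm]
  calc _ = v * (Matrix.diagonal (f ∘ e) * W) * star u := by
        simp only [hW, mul_assoc, hu', mul_one]
    _ = (v * star v) * u * Matrix.diagonal (f ∘ d) * star u := by
        rw [← h2]; simp only [hW, mul_assoc]
    _ = _ := by rw [hv', one_mul]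

end NormalMatrices

end BerezinToeplitz

end

open BerezinToeplitz

noncomputable section

namespace BerezinToeplitz

/-! ### Toeplitz operators and pairings -/

section General

variable {Ω : Type*} [MeasurableSpace Ω] {μ : Measure Ω}
variable {V : Type*} [NormedAddCommGroup V] [InnerProductSpace ℂ V]

/-! Functional calculus turns integrals over normal matrices into scalar Gaussian integrals. For Z =
U⋆ diag(d) U, the number ⟨v, u^#(Z) w⟩ is the sum of the u(dⱼ) with weights conj((Uv)ⱼ) (Uw)ⱼ. Each
dⱼ has law γ_h and the weights add up to ⟨v, w⟩, so the integral over μ_h is (∫ u dγ_h) ⟨v, w⟩: this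
is `integrable_inner_spectral`.

The kernel at a scalar matrix is itself a spectral function, K_h(Z, xI) = (K_x)^#(Z)
(`normalKernel_scalarMatrix`). Hence ⟨T_φ K_{xI,χ}, K_{xI,χ'}⟩ is the integral of ⟨χ', (f |K_x|²)^#
χ⟩. Both ‖K_x‖² and K_h(xI, xI) amount to e^{|x|²/h}, and dividing by it gives part (1).

Part (2) is a squeeze. From above, ‖T_φ‖ ≤ ‖φ‖_∞ because P is a contraction. The Berezin transform
obeys the same bound because χ ↦ K_{X, K(X,X)^{-1/2} χ} is a contraction
(`norm_kernelVec_invSqrt_le`, `norm_berezin_le`); this rests on the orthogonality of the monomials.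
From below, both quantities dominate |T̃_f(x)| for every x, by evaluation at xI. Now T̃_f is the
convolution of f with a Gaussian of width √h (`scalarBerezin_eq`), so T̃_f(x) → f(x) pointwise, and
‖φ‖_∞ = sup |f|. No uniformity in x is needed, and infinite values cause no trouble. -/

theorem mem_toeplitz_domain {H : Submodule ℂ (Lp V 2 μ)} [H.HasOrthogonalProjection]
    {φ : Ω → V →L[ℂ] V} {g : H} :
    g ∈ (toeplitz H φ).domain ↔ MemLp (fun z => φ z ((g : Lp V 2 μ) z)) 2 μ := Iff.rfl

theorem mem_toeplitz_domain_of_ae_eq {H : Submodule ℂ (Lp V 2 μ)} [H.HasOrthogonalProjection]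
    {φ : Ω → V →L[ℂ] V} {g : H} {G : Ω → V} (hG : (g : Lp V 2 μ) =ᵐ[μ] G) :
    g ∈ (toeplitz H φ).domain ↔ MemLp (fun z => φ z (G z)) 2 μ := by
  rw [mem_toeplitz_domain]
  refine memLp_congr_ae ?_
  filter_upwards [hG] with z hz
  rw [hz]

theorem norm_toeplitz_le {H : Submodule ℂ (Lp V 2 μ)} [H.HasOrthogonalProjection]
    {φ : Ω → V →L[ℂ] V} {M : ℝ} (hφ : ∀ z, ‖φ z‖ ≤ M) (u : (toeplitz H φ).domain) :
    ‖toeplitz H φ u‖ ≤ M * ‖u‖ := by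
  refine (H.norm_orthogonalProjectionOnto_apply_le _).trans ?_
  refine Lp.norm_le_mul_norm_of_ae_le_mul ?_
  filter_upwards [(symbolDomain_memLp (φ := φ) (g := ((u : H) : Lp V 2 μ)) u.2).coeFn_toLp]
    with z hz
  refine (congrArg norm hz).le.trans ?_
  exact (φ z).le_of_opNorm_le (hφ z) _

/-- As v lies in H, the projection P drops out of ⟨P(φu), v⟩, and a plain integral is left. -/
theorem pairing_toeplitz {H : Submodule ℂ (Lp V 2 μ)} [H.HasOrthogonalProjection]
    {φ : Ω → V →L[ℂ] V} {u : H} (hu : u ∈ (toeplitz H φ).domain) (v : H) {F G : Ω → V}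
    (hF : (u : Lp V 2 μ) =ᵐ[μ] F) (hG : (v : Lp V 2 μ) =ᵐ[μ] G) :
    pairing (toeplitz H φ) u v = ∫ z, ⟪G z, φ z (F z)⟫_ℂ ∂μ := by
  rw [pairing, dif_pos hu]
  refine (Submodule.inner_orthogonalProjectionOnto_eq_of_mem_left v _).trans ?_
  rw [L2.inner_def]
  refine integral_congr_ae ?_
  filter_upwards [(symbolDomain_memLp (φ := φ) (g := (u : Lp V 2 μ)) hu).coeFn_toLp, hF, hG]
    with z hz h1 h2
  rw [h2, ← h1]
  exact congrArg (fun w => ⟪G z, w⟫_ℂ) hz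

variable {H : Type*} [NormedAddCommGroup H] [InnerProductSpace ℂ H]

/-- Since `pairing` is 0 off the domain, it is sesquilinear only where the vectors are in the
domain; hence the hypothesis on every `u i`. -/
theorem pairing_sum_smul {ι : Type*} (s : Finset ι) (T : H →ₗ.[ℂ] H) (u : ι → H)
    (hu : ∀ i, u i ∈ T.domain) (c d : ι → ℂ) :
    pairing T (∑ j ∈ s, c j • u j) (∑ i ∈ s, d i • u i) =
      ∑ i ∈ s, ∑ j ∈ s, starRingEnd ℂ (d i) * (c j * pairing T (u j) (u i)) := by
  have hm : ∑ j ∈ s, c j • u j ∈ T.domain :=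
    Submodule.sum_mem _ fun j _ => Submodule.smul_mem _ _ (hu j)
  have h1 : T ⟨∑ j ∈ s, c j • u j, hm⟩ = ∑ j ∈ s, c j • T ⟨u j, hu j⟩ := by
    have h2 : (⟨∑ j ∈ s, c j • u j, hm⟩ : T.domain) =
        ∑ j ∈ s, c j • (⟨u j, hu j⟩ : T.domain) := by
      ext; simp
    rw [h2, ← LinearPMap.toFun_eq_coe, map_sum]
    simp only [map_smul]
    rfl
  rw [pairing, dif_pos hm, h1, sum_inner]
  refine Finset.sum_congr rfl fun i _ => ?_
  rw [inner_sum]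
  refine Finset.sum_congr rfl fun j _ => ?_
  rw [pairing, dif_pos (hu j), inner_smul_left, inner_smul_right]

theorem pairing_smul_smul (T : H →ₗ.[ℂ] H) {u : H} (hu : u ∈ T.domain) (c d : ℂ) :
    pairing T (c • u) (d • u) = starRingEnd ℂ d * (c * pairing T u u) := by
  simpa using pairing_sum_smul (Finset.univ : Finset Unit) T (fun _ => u) (fun _ => hu)
    (fun _ => c) (fun _ => d)

theorem norm_pairing_le {T : H →ₗ.[ℂ] H} {M : ℝ} (hM : 0 ≤ M)
    (hT : ∀ u : T.domain, ‖T u‖ ≤ M * ‖u‖) (u v : H) : ‖pairing T u v‖ ≤ M * ‖u‖ * ‖v‖ := by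
  by_cases hu : u ∈ T.domain
  · rw [pairing, dif_pos hu]
    refine (norm_inner_le_norm _ _).trans ?_
    rw [mul_comm]
    gcongr
    exact hT ⟨u, hu⟩
  · rw [pairing, dif_neg hu, norm_zero]
    positivity

theorem opENorm_le {T : H →ₗ.[ℂ] H} {M : ℝ} (hM : 0 ≤ M)
    (hT : ∀ u : T.domain, ‖T u‖ ≤ M * ‖u‖) : opENorm T ≤ ENNReal.ofReal M := by
  refine iSup₂_le fun g hg => ?_
  rw [← ofReal_norm]
  refine ENNReal.ofReal_le_ofReal ((hT g).trans ?_)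
  simpa using mul_le_mul_of_nonneg_left hg hM

theorem enorm_pairing_le_opENorm (T : H →ₗ.[ℂ] H) {u : H} (hu : ‖u‖ ≤ 1) :
    ‖pairing T u u‖ₑ ≤ opENorm T := by
  by_cases hd : u ∈ T.domain
  · rw [pairing, dif_pos hd]
    refine le_trans ?_ (le_iSup₂ (f := fun (g : T.domain) (_ : ‖g‖ ≤ 1) => ‖T g‖ₑ) ⟨u, hd⟩ hu)
    rw [← ofReal_norm, ← ofReal_norm]
    refine ENNReal.ofReal_le_ofReal ((norm_inner_le_norm _ _).trans ?_)
    exact mul_le_of_le_one_left (norm_nonneg _) hu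
  · rw [pairing, dif_neg hd]; simp

end General

/-! ### Gaussian integrals -/

theorem integral_gaussian {E : Type*} [NormedAddCommGroup E] [NormedSpace ℝ E] (h : Planck)
    (g : ℂ → E) : ∫ z, g z ∂(gaussian h) =
      ∫ z : ℂ, ((Real.pi * h)⁻¹ * Real.exp (-‖z‖ ^ 2 / h)) • g z := by
  have hh : (0 : ℝ) < h := h.2
  rw [gaussian, integral_withDensity_eq_integral_toReal_smul (measurable_density h) (by simp)]
  refine integral_congr_ae (ae_of_all _ fun z => ?_)
  beta_reduce
  rw [ENNReal.toReal_ofReal (by positivity)]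

theorem integrable_gaussian_iff {E : Type*} [NormedAddCommGroup E] [NormedSpace ℝ E] (h : Planck)
    (g : ℂ → E) : Integrable g (gaussian h) ↔
      Integrable fun z : ℂ => ((Real.pi * h)⁻¹ * Real.exp (-‖z‖ ^ 2 / h)) • g z := by
  have hh : (0 : ℝ) < h := h.2
  rw [gaussian, integrable_withDensity_iff_integrable_smul' (measurable_density h) (by simp)]
  refine integrable_congr (ae_of_all _ fun z => ?_)
  beta_reduce
  rw [ENNReal.toReal_ofReal (by positivity)]

/-- In polar coordinates this is a Gamma integral, equal to π h^(k+1) Γ(k+1) before normalization.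
The case k = 0 shows that the total mass is 1. -/
theorem integral_gaussian_pow (h : Planck) (k : ℕ) :
    ∫ z, ‖z‖ ^ (2 * k) ∂(gaussian h) = k.factorial * (h : ℝ) ^ k := by
  have hh : (0 : ℝ) < h := h.2
  rw [integral_gaussian]
  have h1 := Complex.integral_rpow_mul_exp_neg_mul_rpow (p := 2) (q := (2 * k : ℕ))
    (b := (h : ℝ)⁻¹) one_le_two (by linarith [(Nat.cast_nonneg (2 * k) : (0 : ℝ) ≤ _)])
    (by positivity)
  calc _ = ∫ z : ℂ, (Real.pi * h)⁻¹ * (‖z‖ ^ ((2 * k : ℕ) : ℝ) *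
        Real.exp (-(h : ℝ)⁻¹ * ‖z‖ ^ (2 : ℝ))) := by
        refine integral_congr_ae (ae_of_all _ fun z => ?_)
        beta_reduce
        rw [smul_eq_mul, Real.rpow_natCast, Real.rpow_two,
          show -‖z‖ ^ 2 / (h : ℝ) = -(h : ℝ)⁻¹ * ‖z‖ ^ 2 by ring]
        ring
    _ = _ := by
        rw [integral_const_mul, h1, show (((2 * k : ℕ) : ℝ) + 2) / 2 = (k : ℝ) + 1 by
          push_cast; ring, Real.Gamma_nat_eq_factorial,
          show -(((2 * k : ℕ) : ℝ) + 2) / 2 = -((k + 1 : ℕ) : ℝ) by push_cast; ring,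
          Real.rpow_neg (by positivity), Real.rpow_natCast, inv_pow, inv_inv, pow_succ]
        field_simp

instance (h : Planck) : IsProbabilityMeasure (gaussian h) := by
  have h1 := integral_gaussian_pow h 0
  simp only [mul_zero, pow_zero, integral_const, Measure.real, smul_eq_mul, mul_one,
    Nat.factorial_zero, Nat.cast_one, ENNReal.toReal_eq_one_iff] at h1
  exact ⟨h1⟩

theorem integrable_pow_gaussian (h : Planck) (k : ℕ) :
    Integrable (fun z : ℂ => ‖z‖ ^ k) (gaussian h) := by
  refine ((integrable_exp_norm h 1).const_mul (k.factorial : ℝ)).mono' (by fun_prop)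
    (ae_of_all _ fun z => ?_)
  rw [Real.norm_of_nonneg (by positivity), one_mul, mul_comm]
  exact (div_le_iff₀ (by positivity)).1 (Real.pow_div_factorial_le_exp ‖z‖ (norm_nonneg _) k)

theorem integral_gaussian_rotate (h : Planck) (a : Circle) (g : ℂ → ℂ) :
    ∫ z, g (a * z) ∂(gaussian h) = ∫ z, g z ∂(gaussian h) := by
  rw [integral_gaussian, integral_gaussian]
  conv_rhs =>
    rw [← (rotation a).measurePreserving.integral_comp (rotation a).toHomeomorph.measurableEmbedding]
  simp [rotation_apply, Circle.norm_coe]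

/-- Rotating by a unimodular a multiplies the integral by conj(a)^k a^m, so it vanishes as soon as
a^k ≠ a^m. -/
theorem integral_conj_pow_mul_pow_of_ne (h : Planck) {k m : ℕ} (hkm : k ≠ m) :
    ∫ z, starRingEnd ℂ z ^ k * z ^ m ∂(gaussian h) = 0 := by
  obtain ⟨a, ha⟩ : ∃ a : Circle, (a : ℂ) ^ m ≠ (a : ℂ) ^ k := by
    -- The rotation by one radian serves all k ≠ m at once: a^m = a^k would make π rational.
    refine ⟨Circle.exp 1, fun h0 => hkm ?_⟩
    rw [← Circle.coe_pow, ← Circle.coe_pow, ← Circle.exp_natCast_mul, ← Circle.exp_natCast_mul,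
      Circle.coe_inj, mul_one, mul_one, Circle.exp_eq_exp] at h0
    obtain ⟨n, hn⟩ := h0
    by_contra hne
    have hn0 : n ≠ 0 := by
      rintro rfl
      simp at hn
      exact hne hn.symm
    refine irrational_pi ⟨((m : ℚ) - k) / (n * 2), ?_⟩
    push_cast
    rw [hn]
    field_simp
    ring
  have h1 := integral_gaussian_rotate h a fun z => starRingEnd ℂ z ^ k * z ^ m
  have h2 : ∀ z : ℂ, starRingEnd ℂ (a * z) ^ k * (a * z) ^ m =
      (starRingEnd ℂ (a : ℂ) ^ k * (a : ℂ) ^ m) * (starRingEnd ℂ z ^ k * z ^ m) := fun z => by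
    rw [map_mul, mul_pow, mul_pow]; ring
  simp only [h2] at h1
  rw [integral_const_mul] at h1
  by_contra hI
  have h3 := mul_right_cancel₀ hI (h1.trans (one_mul _).symm)
  refine ha ?_
  have h4 : (a : ℂ) * starRingEnd ℂ (a : ℂ) = 1 := by
    rw [Complex.mul_conj, Circle.normSq_coe, Complex.ofReal_one]
  calc (a : ℂ) ^ m = (a * starRingEnd ℂ (a : ℂ)) ^ k * (a : ℂ) ^ m := by rw [h4]; simp
    _ = (a : ℂ) ^ k * (starRingEnd ℂ (a : ℂ) ^ k * (a : ℂ) ^ m) := by rw [mul_pow]; ring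
    _ = (a : ℂ) ^ k := by rw [h3, mul_one]

theorem integral_conj_pow_mul_pow (h : Planck) (k : ℕ) :
    ∫ z, starRingEnd ℂ z ^ k * z ^ k ∂(gaussian h) = ((k.factorial * (h : ℝ) ^ k : ℝ) : ℂ) := by
  rw [← integral_gaussian_pow, ← integral_complex_ofReal]
  refine integral_congr_ae (ae_of_all _ fun z => ?_)
  beta_reduce
  rw [← mul_pow, Complex.conj_mul']
  push_cast
  rw [pow_mul]

/-! ### Scalar kernel functions -/

theorem coeFn_scalarKernelVec (h : Planck) (x : ℂ) :
    ((scalarKernelVec h x : segalBargmann h) : Lp ℂ 2 (gaussian h)) =ᵐ[gaussian h]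
      scalarKernel h x := (memLp_scalarKernel h x).coeFn_toLp

theorem norm_scalarKernel_le (h : Planck) (x z : ℂ) :
    ‖scalarKernel h x z‖ ≤ Real.exp (‖x‖ / h * ‖z‖) := by
  have hh : (0 : ℝ) < h := h.2
  rw [scalarKernel, Complex.norm_exp]
  refine Real.exp_le_exp.2 ((Complex.re_le_norm _).trans_eq ?_)
  simp [abs_of_pos hh]
  ring

/-- Completing the square: |z|² - 2 Re(z x̄) + |x|² = |x - z|². -/
theorem density_mul_norm_scalarKernel_sq (h : Planck) (x z : ℂ) :
    Real.exp (-‖z‖ ^ 2 / h) * ‖scalarKernel h x z‖ ^ 2 =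
      Real.exp (‖x‖ ^ 2 / h) * Real.exp (-‖x - z‖ ^ 2 / h) := by
  rw [scalarKernel, Complex.norm_exp, ← Real.exp_nat_mul, ← Real.exp_add, ← Real.exp_add]
  congr 1
  rw [Complex.div_ofReal_re, ← Complex.normSq_eq_norm_sq, ← Complex.normSq_eq_norm_sq,
    ← Complex.normSq_eq_norm_sq, Complex.normSq_apply, Complex.normSq_apply, Complex.normSq_apply]
  simp
  ring

theorem integral_mul_norm_scalarKernel_sq (h : Planck) (x : ℂ) (f : ℂ → ℂ) :
    ∫ z, f z * (‖scalarKernel h x z‖ ^ 2 : ℝ) ∂(gaussian h) = (Real.exp (‖x‖ ^ 2 / h) : ℝ) *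
      ∫ z : ℂ, ((Real.pi * h)⁻¹ * Real.exp (-‖x - z‖ ^ 2 / h)) • f z := by
  rw [integral_gaussian, ← integral_const_mul]
  refine integral_congr_ae (ae_of_all _ fun z => ?_)
  have h1 := congrArg (fun t : ℝ => (t : ℂ)) (density_mul_norm_scalarKernel_sq h x z)
  simp only [Complex.ofReal_mul] at h1
  simp only [Complex.real_smul, Complex.ofReal_mul]
  linear_combination ((Real.pi * h)⁻¹ : ℝ) * f z * h1

theorem integral_gaussian_density (h : Planck) (x : ℂ) :
    ∫ z : ℂ, (Real.pi * h)⁻¹ * Real.exp (-‖x - z‖ ^ 2 / h) = 1 := by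
  rw [integral_sub_left_eq_self (fun z : ℂ => (Real.pi * h)⁻¹ * Real.exp (-‖z‖ ^ 2 / h))]
  simpa using (integral_gaussian h fun _ => (1 : ℝ)).symm

theorem norm_scalarKernelVec_sq (h : Planck) (x : ℂ) :
    ‖scalarKernelVec h x‖ ^ 2 = Real.exp (‖x‖ ^ 2 / h) := by
  have h1 := inner_self_eq_norm_sq_to_K (𝕜 := ℂ) (scalarKernelVec h x : Lp ℂ 2 (gaussian h))
  rw [L2.inner_def] at h1
  have h2 : ∫ z, ⟪(scalarKernelVec h x : Lp ℂ 2 (gaussian h)) z,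
      (scalarKernelVec h x : Lp ℂ 2 (gaussian h)) z⟫_ℂ ∂(gaussian h) =
      ∫ z, 1 * ((‖scalarKernel h x z‖ ^ 2 : ℝ) : ℂ) ∂(gaussian h) := by
    refine integral_congr_ae ?_
    filter_upwards [coeFn_scalarKernelVec h x] with z hz
    rw [hz, inner_self_eq_norm_sq_to_K, one_mul]
    push_cast; rfl
  have h4 : ∫ z : ℂ, ((Real.pi * h)⁻¹ * Real.exp (-‖x - z‖ ^ 2 / h)) • (1 : ℂ) = 1 := by
    rw [integral_smul_const, integral_gaussian_density, one_smul]
  rw [h2, integral_mul_norm_scalarKernel_sq h x (fun _ => 1), h4, mul_one] at h1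
  refine Complex.ofReal_injective ?_
  rw [h1]
  push_cast
  rfl

theorem scalarKernelVec_mem_domain_iff (h : Planck) (f : ℂ → ℂ) (x : ℂ) :
    scalarKernelVec h x ∈ (scalarToeplitz h f).domain ↔
      MemLp (fun z => f z * scalarKernel h x z) 2 (gaussian h) :=
  mem_toeplitz_domain_of_ae_eq (coeFn_scalarKernelVec h x)

/-- The normalized density |K_x|² dγ_h / ‖K_x‖² is the Gaussian centred at x, so the Berezin
transform is a heat convolution of f. -/
theorem scalarBerezin_eq (h : Planck) {f : ℂ → ℂ} {x : ℂ}
    (hx : scalarKernelVec h x ∈ (scalarToeplitz h f).domain) :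
    scalarBerezin (scalarToeplitz h f) x =
      ∫ z : ℂ, ((Real.pi * h)⁻¹ * Real.exp (-‖x - z‖ ^ 2 / h)) • f z := by
  rw [scalarBerezin]
  rw [pairing_smul_smul _ hx, scalarToeplitz, pairing_toeplitz hx _ (coeFn_scalarKernelVec h x)
    (coeFn_scalarKernelVec h x)]
  have h1 : ∫ z, ⟪scalarKernel h x z, (f z • ContinuousLinearMap.id ℂ ℂ) (scalarKernel h x z)⟫_ℂ
      ∂(gaussian h) = ∫ z, f z * (‖scalarKernel h x z‖ ^ 2 : ℝ) ∂(gaussian h) := by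
    refine integral_congr_ae (ae_of_all _ fun z => ?_)
    simp only [smul_apply, ContinuousLinearMap.id_apply, smul_eq_mul]
    rw [← smul_eq_mul (f z), inner_smul_right, inner_self_eq_norm_sq_to_K]
    push_cast; rfl
  rw [h1, integral_mul_norm_scalarKernel_sq, Complex.conj_ofReal, ← mul_assoc, ← mul_assoc,
    ← norm_scalarKernelVec_sq]
  have h2 : ‖scalarKernelVec h x‖ ≠ 0 := by
    have := norm_scalarKernelVec_sq h x
    intro h0
    rw [h0] at this
    exact (Real.exp_pos _).ne (by simpa using this)
  rw [← Complex.ofReal_mul, ← Complex.ofReal_mul]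
  rw [show ‖scalarKernelVec h x‖⁻¹ * ‖scalarKernelVec h x‖⁻¹ * ‖scalarKernelVec h x‖ ^ 2 = 1 by
    field_simp]
  rw [Complex.ofReal_one, one_mul]

/-! ### The semiclassical limit of the scalar Berezin transform -/

theorem integrable_sq_mul_exp_gaussian {f : ℂ → ℂ} {h h₀ : Planck}
    (hf : Continuous f) (hh₀ : h < h₀) (hL : MemLp f 2 (gaussian h₀)) (a : ℝ) :
    Integrable (fun z : ℂ => ‖f z‖ ^ 2 * Real.exp (a * ‖z‖)) (gaussian h) := by
  have hh : (0 : ℝ) < h := h.2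
  have hh' : (0 : ℝ) < h₀ := h₀.2
  have hlt : (h : ℝ) < h₀ := hh₀
  have h1 := (integrable_gaussian_iff h₀ _).1 hL.norm.integrable_sq
  rw [integrable_gaussian_iff]
  -- The gap between the two Gaussian rates pays for the exponential: a r - c r² ≤ a²/(4c), by
  -- completing the square.
  set c : ℝ := (h : ℝ)⁻¹ - (h₀ : ℝ)⁻¹ with hc
  have hc0 : 0 < c := sub_pos.2 ((inv_lt_inv₀ hh' hh).2 hlt)
  refine (h1.const_mul (h₀ / h * Real.exp (a ^ 2 / (4 * c)))).mono'
    (Continuous.aestronglyMeasurable (by fun_prop)) (ae_of_all _ fun z => ?_)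
  rw [Real.norm_of_nonneg (by positivity), smul_eq_mul, smul_eq_mul]
  have h2 : -‖z‖ ^ 2 / h + a * ‖z‖ ≤ a ^ 2 / (4 * c) + -‖z‖ ^ 2 / h₀ := by
    have h3 : 0 ≤ (a - 2 * c * ‖z‖) ^ 2 / (4 * c) := by positivity
    have h4 : (a - 2 * c * ‖z‖) ^ 2 / (4 * c) = a ^ 2 / (4 * c) - a * ‖z‖ + c * ‖z‖ ^ 2 := by
      field_simp; ring
    have h5 : c * ‖z‖ ^ 2 = -(-‖z‖ ^ 2 / h) + -‖z‖ ^ 2 / h₀ := by rw [hc]; ring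
    linarith
  have h6 := Real.exp_le_exp.2 h2
  rw [Real.exp_add, Real.exp_add] at h6
  calc _ = (Real.pi * h)⁻¹ * ‖f z‖ ^ 2 * (Real.exp (-‖z‖ ^ 2 / h) * Real.exp (a * ‖z‖)) := by ring
    _ ≤ (Real.pi * h)⁻¹ * ‖f z‖ ^ 2 *
        (Real.exp (a ^ 2 / (4 * c)) * Real.exp (-‖z‖ ^ 2 / h₀)) := by gcongr
    _ = _ := by field_simp

theorem memLp_mul_scalarKernel {f : ℂ → ℂ} {h h₀ : Planck} (hf : Continuous f) (hh₀ : h < h₀)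
    (hL : MemLp f 2 (gaussian h₀)) (x : ℂ) :
    MemLp (fun z => f z * scalarKernel h x z) 2 (gaussian h) := by
  have hk := (differentiable_scalarKernel h x).continuous
  rw [memLp_two_iff_integrable_sq_norm (show Continuous fun z => f z * scalarKernel h x z from hf.mul hk).aestronglyMeasurable]
  refine (integrable_sq_mul_exp_gaussian hf hh₀ hL (2 * (‖x‖ / h))).mono'
    (Continuous.aestronglyMeasurable (by fun_prop)) (ae_of_all _ fun z => ?_)
  rw [Real.norm_of_nonneg (by positivity), norm_mul, mul_pow]
  gcongr
  calc _ ≤ Real.exp (‖x‖ / h * ‖z‖) ^ 2 := by gcongr; exact norm_scalarKernel_le h x z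
    _ = _ := by rw [← Real.exp_nat_mul]; congr 1; push_cast; ring

theorem integrable_exp_neg_sq_smul {f : ℂ → ℂ} {h h₀ : Planck} (hf : Continuous f) (hh₀ : h < h₀)
    (hL : MemLp f 2 (gaussian h₀)) (x : ℂ) :
    Integrable fun z : ℂ => Real.exp (-‖x - z‖ ^ 2 / h) • f z := by
  have hh : (0 : ℝ) < h := h.2
  have h1 : Integrable (fun z => (‖scalarKernel h x z‖ ^ 2 : ℝ) • f z) (gaussian h) := by
    -- Here f |K_x|² is the product of the two L² functions f K_x and conj K_x.
    have h2 := (memLp_mul_scalarKernel hf hh₀ hL x).integrable_mul (memLp_scalarKernel h x).star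
    refine h2.congr (ae_of_all _ fun z => ?_)
    simp only [Pi.mul_apply, Pi.star_apply, RCLike.star_def]
    rw [mul_assoc, Complex.mul_conj', Complex.real_smul]
    push_cast; ring
  rw [integrable_gaussian_iff] at h1
  refine (h1.const_mul (Real.pi * h * Real.exp (-(‖x‖ ^ 2 / h)) : ℝ)).congr
    (ae_of_all _ fun z => ?_)
  have h3 := density_mul_norm_scalarKernel_sq h x z
  simp only [smul_smul]
  rw [← Complex.real_smul, smul_smul]
  congr 1
  calc _ = (Real.pi * h) * (Real.pi * h)⁻¹ * (Real.exp (-(‖x‖ ^ 2 / h)) *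
        (Real.exp (-‖z‖ ^ 2 / h) * ‖scalarKernel h x z‖ ^ 2)) := by ring
    _ = _ := by
      rw [h3, ← mul_assoc (Real.exp _), ← Real.exp_add, neg_add_cancel, Real.exp_zero, one_mul,
        mul_inv_cancel₀ (by positivity), one_mul]

theorem tendsto_norm_pow_mul_gaussian :
    Tendsto (fun z : ℂ => ‖z‖ ^ Module.finrank ℝ ℂ * (Real.pi⁻¹ * Real.exp (-‖z‖ ^ 2)))
      (Bornology.cobounded ℂ) (𝓝 0) := by
  have h1 := ((Real.tendsto_pow_mul_exp_neg_atTop_nhds_zero 1).comp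
    ((tendsto_pow_atTop two_ne_zero).comp (tendsto_norm_cobounded_atTop (E := ℂ)))).const_mul
      Real.pi⁻¹
  rw [mul_zero] at h1
  refine h1.congr fun z => ?_
  simp only [Function.comp_apply, pow_one, Complex.finrank_real_complex]
  ring

theorem eventually_hZero_lt (h₀ : Planck) : ∀ᶠ h in hZero, h < h₀ :=
  preimage_mem_comap (Iio_mem_nhds (show (0 : ℝ) < h₀ from h₀.2))

/-- An approximate identity argument. As f need not be Lebesgue integrable, a fixed factor exp(-|x -
z|²/h₁) is split off the Gaussian and attached to f; it equals 1 at z = x, so the limit is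
unaffected. -/
theorem tendsto_integral_gaussian_smul {f : ℂ → ℂ} (hf : Continuous f) {h₀ : Planck}
    (hL : MemLp f 2 (gaussian h₀)) (x : ℂ) :
    Tendsto (fun h : Planck =>
      ∫ z : ℂ, ((Real.pi * h)⁻¹ * Real.exp (-‖x - z‖ ^ 2 / h)) • f z) hZero (𝓝 (f x)) := by
  obtain ⟨h₁, hlt⟩ : ∃ h₁ : Planck, h₁ < h₀ :=
    ⟨⟨h₀ / 2, half_pos h₀.2⟩, half_lt_self h₀.2⟩
  have hh₁ : (0 : ℝ) < h₁ := h₁.2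
  have hg := integrable_exp_neg_sq_smul hf hlt hL x
  have hφ : ∫ z : ℂ, Real.pi⁻¹ * Real.exp (-‖z‖ ^ 2) = 1 := by
    have := integral_gaussian_density ⟨1, one_pos⟩ 0
    simpa using this
  have key := tendsto_integral_comp_smul_smul_of_integrable' (μ := (volume : Measure ℂ))
    (φ := fun z : ℂ => Real.pi⁻¹ * Real.exp (-‖z‖ ^ 2)) (fun z => by positivity) hφ
    tendsto_norm_pow_mul_gaussian hg (x₀ := x) (Continuous.continuousAt (by fun_prop))
  have hval : Tendsto (fun h : Planck => (h : ℝ)) hZero (𝓝 0) := tendsto_comap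
  have hval' : Tendsto (fun h : Planck => (h : ℝ)) hZero (𝓝[>] 0) :=
    tendsto_nhdsWithin_iff.2 ⟨hval, Eventually.of_forall fun h => h.2⟩
  -- The remaining Gaussian has rate 1/h - 1/h₁, so it is the unit Gaussian dilated by the square
  -- root of this rate.
  have hc : Tendsto (fun h : Planck => √((h : ℝ)⁻¹ - (h₁ : ℝ)⁻¹)) hZero atTop :=
    Real.tendsto_sqrt_atTop.comp
      (tendsto_atTop_add_const_right _ _ (tendsto_inv_nhdsGT_zero.comp hval'))
  -- This factor turns the normalization 1/h - 1/h₁ of the dilated Gaussian into the required 1/h.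
  have hs : Tendsto (fun h : Planck => ((1 : ℝ) - h / h₁)⁻¹) hZero (𝓝 1) := by
    have := ((hval.div_const (h₁ : ℝ)).const_sub 1).inv₀ (by simp)
    simpa using this
  have hlim := hs.smul (key.comp hc)
  simp only [sub_self, norm_zero, ne_eq, OfNat.ofNat_ne_zero, not_false_eq_true, zero_pow,
    neg_zero, zero_div, Real.exp_zero, one_smul] at hlim
  refine hlim.congr' ?_
  filter_upwards [eventually_hZero_lt h₁] with h hh
  have hh0 : (0 : ℝ) < h := h.2
  have hhlt : (h : ℝ) < h₁ := hh
  have hd : 0 < (h : ℝ)⁻¹ - (h₁ : ℝ)⁻¹ := sub_pos.2 ((inv_lt_inv₀ hh₁ hh0).2 hhlt)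
  rw [Function.comp_apply, ← integral_smul]
  refine integral_congr_ae (ae_of_all _ fun z => ?_)
  simp only [smul_smul]
  congr 1
  rw [Complex.finrank_real_complex, Real.sq_sqrt hd.le, norm_smul, mul_pow, Real.norm_eq_abs,
    sq_abs, Real.sq_sqrt hd.le]
  have e1 : -‖x - z‖ ^ 2 / (h : ℝ) =
      -(((h : ℝ)⁻¹ - (h₁ : ℝ)⁻¹) * ‖x - z‖ ^ 2) + -‖x - z‖ ^ 2 / h₁ := by ring
  have e2 : ((1 : ℝ) - h / h₁)⁻¹ * ((h : ℝ)⁻¹ - (h₁ : ℝ)⁻¹) = (h : ℝ)⁻¹ := by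
    have : (h₁ : ℝ) - h ≠ 0 := (sub_pos.2 hhlt).ne'
    field_simp
  rw [e1, Real.exp_add, mul_inv]
  linear_combination (Real.pi⁻¹ * Real.exp (-(((h : ℝ)⁻¹ - (h₁ : ℝ)⁻¹) * ‖x - z‖ ^ 2)) *
    Real.exp (-‖x - z‖ ^ 2 / h₁)) * e2

/-! ### Spectral functions on normal matrices -/

section NormalMatrices

open scoped Matrix.Norms.L2Operator

variable {N : ℕ}

theorem spectral_conjDiag (f : ℂ → ℂ) (U : Matrix.unitaryGroup (Fin N) ℂ) (d : Fin N → ℂ) :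
    spectral f (conjDiag U d) =
      star (U : Matrix (Fin N) (Fin N) ℂ) * Matrix.diagonal (f ∘ d) * U := by
  have h1 := spectral_eq f (conjDiag U d) (star U) d (by
    rw [conjDiag, Unitary.coe_star, star_star])
  rwa [Unitary.coe_star, star_star] at h1

theorem toEuclideanCLM_mul_apply (A B : Matrix (Fin N) (Fin N) ℂ) (v : EuclideanSpace ℂ (Fin N)) :
    Matrix.toEuclideanCLM (𝕜 := ℂ) (A * B) v =
      Matrix.toEuclideanCLM (𝕜 := ℂ) A (Matrix.toEuclideanCLM (𝕜 := ℂ) B v) := by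
  rw [map_mul]; rfl

theorem inner_toEuclideanCLM_unitary (U : Matrix.unitaryGroup (Fin N) ℂ)
    (v w : EuclideanSpace ℂ (Fin N)) :
    ⟪Matrix.toEuclideanCLM (𝕜 := ℂ) U.1 v, Matrix.toEuclideanCLM (𝕜 := ℂ) U.1 w⟫_ℂ = ⟪v, w⟫_ℂ := by
  rw [← ContinuousLinearMap.adjoint_inner_right, ← ContinuousLinearMap.star_eq_adjoint,
    ← map_star, ← toEuclideanCLM_mul_apply, Unitary.coe_star_mul_self, map_one]
  rfl

theorem inner_toEuclideanCLM_star (A : Matrix (Fin N) (Fin N) ℂ)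
    (v w : EuclideanSpace ℂ (Fin N)) :
    ⟪v, Matrix.toEuclideanCLM (𝕜 := ℂ) (star A) w⟫_ℂ =
      ⟪Matrix.toEuclideanCLM (𝕜 := ℂ) A v, w⟫_ℂ := by
  rw [map_star, ContinuousLinearMap.star_eq_adjoint, ContinuousLinearMap.adjoint_inner_right]

theorem inner_toEuclideanCLM_conj_diagonal (U : Matrix.unitaryGroup (Fin N) ℂ) (d : Fin N → ℂ)
    (v w : EuclideanSpace ℂ (Fin N)) :
    ⟪v, Matrix.toEuclideanCLM (𝕜 := ℂ)
      (star (U : Matrix (Fin N) (Fin N) ℂ) * Matrix.diagonal d * U.1) w⟫_ℂ =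
      ∑ j, ⟪Matrix.toEuclideanCLM (𝕜 := ℂ) U.1 v j, Matrix.toEuclideanCLM (𝕜 := ℂ) U.1 w j⟫_ℂ *
        d j := by
  rw [mul_assoc, toEuclideanCLM_mul_apply, inner_toEuclideanCLM_star, toEuclideanCLM_mul_apply,
    PiLp.inner_apply]
  refine Finset.sum_congr rfl fun j _ => ?_
  rw [Matrix.ofLp_toEuclideanCLM (Matrix.diagonal d), Matrix.mulVec_diagonal]
  simp only [RCLike.inner_apply]
  ring

/-! ### The support of the measure and measurability of spectral functions -/

/-- The range of `(U, d) ↦ U⋆ diag(d) U`. -/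
def diagonalizable (N : ℕ) : Set (NormalMatrix N) :=
  Set.range fun p : Matrix.unitaryGroup (Fin N) ℂ × (Fin N → ℂ) => conjDiag p.1 p.2

/-- The map is proper: U(N) is compact, and ‖U⋆ diag(d) U‖ = ‖d‖ keeps d bounded over a compact set.
-/
theorem isClosedMap_conjDiag (N : ℕ) : IsClosedMap
    fun p : Matrix.unitaryGroup (Fin N) ℂ × (Fin N → ℂ) => conjDiag p.1 p.2 := by
  refine IsProperMap.isClosedMap (isProperMap_iff_isCompact_preimage.2
    ⟨continuous_conjDiag N, fun K hK => ?_⟩)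
  obtain ⟨R, hR⟩ := (hK.image continuous_subtype_val).isBounded.subset_closedBall 0
  refine (isCompact_univ.prod (isCompact_closedBall (0 : Fin N → ℂ) R)).of_isClosed_subset
    (hK.isClosed.preimage (continuous_conjDiag N)) fun p hp => ⟨trivial, ?_⟩
  have h1 := hR ⟨_, hp, rfl⟩
  rw [mem_closedBall_zero_iff] at h1 ⊢
  rwa [norm_conjDiag] at h1

theorem isClosed_diagonalizable (N : ℕ) : IsClosed (diagonalizable N) :=
  (isClosedMap_conjDiag N).isClosed_range

theorem ae_mem_diagonalizable (h : Planck) :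
    ∀ᵐ Z ∂(normalMeasure N h), Z ∈ diagonalizable N := by
  rw [normalMeasure]
  refine (ae_map_iff (continuous_conjDiag N).aemeasurable
    (isClosed_diagonalizable N).measurableSet).2 ?_
  exact ae_of_all _ fun p => ⟨p, rfl⟩

/-- Almost everywhere claims need checking only on matrices U⋆ diag(d) U, where spectral functions
are explicit. This makes the spectral theorem for normal matrices unnecessary. -/
theorem ae_normalMeasure {p : NormalMatrix N → Prop} (h : Planck)
    (hp : ∀ U d, p (conjDiag U d)) : ∀ᵐ Z ∂(normalMeasure N h), p Z := by
  filter_upwards [ae_mem_diagonalizable h]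
  rintro _ ⟨q, rfl⟩
  exact hp q.1 q.2

/-- Continuity descends along a closed map: the preimage of a closed set under f^# is, within the
range, the image of a closed set of pairs (U, d). -/
theorem continuousOn_spectral {f : ℂ → ℂ} (hf : Continuous f) :
    ContinuousOn (spectral (N := N) f) (diagonalizable N) := by
  rw [continuousOn_iff_isClosed]
  intro t ht
  refine ⟨_, isClosedMap_conjDiag N _ (ht.preimage
    (f := fun p : Matrix.unitaryGroup (Fin N) ℂ × (Fin N → ℂ) => spectral f (conjDiag p.1 p.2))
      ?_), ?_⟩
  · simp only [spectral_conjDiag]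
    have h1 : Continuous fun p : Matrix.unitaryGroup (Fin N) ℂ × (Fin N → ℂ) =>
        (p.1 : Matrix (Fin N) (Fin N) ℂ) := continuous_subtype_val.comp continuous_fst
    have h2 : Continuous fun p : Matrix.unitaryGroup (Fin N) ℂ × (Fin N → ℂ) => f ∘ p.2 :=
      continuous_pi fun j => hf.comp ((continuous_apply j).comp continuous_snd)
    exact (h1.star.mul h2.matrix_diagonal).mul h1
  · ext Z
    constructor
    · rintro ⟨hZ, ⟨p, rfl⟩⟩
      exact ⟨⟨p, hZ, rfl⟩, ⟨p, rfl⟩⟩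
    · rintro ⟨⟨p, hp, rfl⟩, hZ⟩
      exact ⟨hp, hZ⟩

theorem aestronglyMeasurable_spectral {f : ℂ → ℂ} (hf : Continuous f) (h : Planck) :
    AEStronglyMeasurable (spectral (N := N) f) (normalMeasure N h) := by
  have h1 := (continuousOn_spectral (N := N) hf).aestronglyMeasurable
    (μ := normalMeasure N h) (isClosed_diagonalizable N).measurableSet
  rwa [Measure.restrict_eq_self_of_ae_mem (ae_mem_diagonalizable h)] at h1

theorem aestronglyMeasurable_spectral_apply {f : ℂ → ℂ} (hf : Continuous f) (h : Planck)
    {G : NormalMatrix N → EuclideanSpace ℂ (Fin N)}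
    (hG : AEStronglyMeasurable G (normalMeasure N h)) :
    AEStronglyMeasurable (fun Z => Matrix.toEuclideanCLM (𝕜 := ℂ) (spectral f Z) (G Z))
      (normalMeasure N h) := by
  have h1 : Continuous (Matrix.toEuclideanCLM (𝕜 := ℂ) (n := Fin N)) :=
    (Matrix.toEuclideanCLM (𝕜 := ℂ) (n := Fin N)).toAlgEquiv.toLinearMap
      |>.continuous_of_finiteDimensional
  exact (ContinuousLinearMap.id ℂ (EuclideanSpace ℂ (Fin N) →L[ℂ] EuclideanSpace ℂ (Fin N)))
    |>.aestronglyMeasurable_comp₂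
      (h1.comp_aestronglyMeasurable (aestronglyMeasurable_spectral hf h)) hG

instance (N : ℕ) : IsProbabilityMeasure (unitaryHaar N) :=
  ⟨by
    rw [unitaryHaar]
    exact Measure.haarMeasure_self⟩

/-- The integrand is ∑ⱼ cⱼ(U) u(dⱼ). Fubini separates U from d, every dⱼ contributes the same ∫ u
dγ_h, and ∑ⱼ cⱼ(U) = ⟨Uv, Uw⟩ = ⟨v, w⟩ for each U. Of Haar measure only finiteness and total mass 1
enter. -/
theorem integrable_inner_spectral {u : ℂ → ℂ} (hu : Continuous u) {h : Planck}
    (hi : Integrable u (gaussian h)) (v w : EuclideanSpace ℂ (Fin N)) :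
    Integrable (fun Z => ⟪v, Matrix.toEuclideanCLM (𝕜 := ℂ) (spectral u Z) w⟫_ℂ)
      (normalMeasure N h) ∧
    ∫ Z, ⟪v, Matrix.toEuclideanCLM (𝕜 := ℂ) (spectral u Z) w⟫_ℂ ∂(normalMeasure N h) =
      (∫ z, u z ∂(gaussian h)) * ⟪v, w⟫_ℂ := by
  set c : Fin N → Matrix.unitaryGroup (Fin N) ℂ → ℂ := fun j U =>
    ⟪Matrix.toEuclideanCLM (𝕜 := ℂ) U.1 v j, Matrix.toEuclideanCLM (𝕜 := ℂ) U.1 w j⟫_ℂ with hc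
  have hcc : ∀ j, Continuous (c j) := by
    intro j
    have h1 : ∀ x : EuclideanSpace ℂ (Fin N), Continuous fun U : Matrix.unitaryGroup (Fin N) ℂ =>
        Matrix.toEuclideanCLM (𝕜 := ℂ) U.1 x j := fun x =>
      (EuclideanSpace.proj j).continuous.comp
        ((continuous_toEuclideanCLM x).comp continuous_subtype_val)
    exact (h1 v).inner (h1 w)
  have hci : ∀ j, Integrable (c j) (unitaryHaar N) := fun j =>
    (hcc j).integrable_of_hasCompactSupport (HasCompactSupport.of_compactSpace _)
  have hui : ∀ j : Fin N, Integrable (fun d : Fin N → ℂ => u (d j))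
      (Measure.pi fun _ : Fin N => gaussian h) := fun j =>
    (measurePreserving_eval (fun _ : Fin N => gaussian h) j).integrable_comp_of_integrable hi
  have hm : AEStronglyMeasurable
      (fun Z => ⟪v, Matrix.toEuclideanCLM (𝕜 := ℂ) (spectral u Z) w⟫_ℂ) (normalMeasure N h) :=
    aestronglyMeasurable_const.inner
      (aestronglyMeasurable_spectral_apply hu h aestronglyMeasurable_const)
  have he : (fun p : Matrix.unitaryGroup (Fin N) ℂ × (Fin N → ℂ) =>
      ⟪v, Matrix.toEuclideanCLM (𝕜 := ℂ) (spectral u (conjDiag p.1 p.2)) w⟫_ℂ) =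
      fun p => ∑ j, c j p.1 * u (p.2 j) := by
    funext p
    rw [spectral_conjDiag, inner_toEuclideanCLM_conj_diagonal]
    rfl
  have hpi : ∀ j, Integrable
      (fun p : Matrix.unitaryGroup (Fin N) ℂ × (Fin N → ℂ) => c j p.1 * u (p.2 j))
      ((unitaryHaar N).prod (Measure.pi fun _ : Fin N => gaussian h)) := fun j =>
    (hci j).mul_prod (hui j)
  constructor
  · rw [normalMeasure, integrable_map_measure hm (continuous_conjDiag N).aemeasurable]
    change Integrable (fun p => _) _
    simp only [Function.comp_def]
    rw [he]
    exact integrable_finsetSum _ fun j _ => hpi j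
  · rw [normalMeasure, integral_map (continuous_conjDiag N).aemeasurable hm, he,
      integral_finsetSum _ fun j _ => hpi j]
    have h2 : ∀ j : Fin N, ∫ p : Matrix.unitaryGroup (Fin N) ℂ × (Fin N → ℂ), c j p.1 * u (p.2 j)
        ∂((unitaryHaar N).prod (Measure.pi fun _ : Fin N => gaussian h)) =
        (∫ U, c j U ∂(unitaryHaar N)) * ∫ z, u z ∂(gaussian h) := fun j => by
      rw [integral_prod_mul (c j) fun d : Fin N → ℂ => u (d j),
        integral_comp_eval (μ := fun _ : Fin N => gaussian h) hi.1]
    simp only [h2]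
    rw [← Finset.sum_mul, ← integral_finsetSum _ fun j _ => hci j, mul_comm]
    congr 1
    have h3 : ∀ U, ∑ j, c j U = ⟪v, w⟫_ℂ := fun U => by
      rw [← inner_toEuclideanCLM_unitary U v w, PiLp.inner_apply]
    simp only [h3]
    simp

/-! ### The functional calculus is a star-homomorphism -/

theorem spectral_mul_conjDiag (u v : ℂ → ℂ) (U : Matrix.unitaryGroup (Fin N) ℂ)
    (d : Fin N → ℂ) : spectral u (conjDiag U d) * spectral v (conjDiag U d) =
      spectral (fun z => u z * v z) (conjDiag U d) := by
  have hU : (U : Matrix (Fin N) (Fin N) ℂ) * star (U : Matrix (Fin N) (Fin N) ℂ) = 1 :=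
    Unitary.coe_mul_star_self U
  rw [spectral_conjDiag, spectral_conjDiag, spectral_conjDiag, mul_assoc, mul_assoc,
    ← mul_assoc U.1, ← mul_assoc U.1, hU, one_mul, ← mul_assoc (Matrix.diagonal _),
    Matrix.diagonal_mul_diagonal, mul_assoc]
  rfl

theorem star_spectral_conjDiag (u : ℂ → ℂ) (U : Matrix.unitaryGroup (Fin N) ℂ)
    (d : Fin N → ℂ) : star (spectral u (conjDiag U d)) =
      spectral (fun z => starRingEnd ℂ (u z)) (conjDiag U d) := by
  rw [spectral_conjDiag, spectral_conjDiag, star_mul, star_mul, star_star,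
    Matrix.star_eq_conjTranspose (Matrix.diagonal _), Matrix.diagonal_conjTranspose, mul_assoc]
  rfl

theorem norm_spectral_apply_sq (u : ℂ → ℂ) (U : Matrix.unitaryGroup (Fin N) ℂ) (d : Fin N → ℂ)
    (w : EuclideanSpace ℂ (Fin N)) :
    ((‖Matrix.toEuclideanCLM (𝕜 := ℂ) (spectral u (conjDiag U d)) w‖ ^ 2 : ℝ) : ℂ) =
      ⟪w, Matrix.toEuclideanCLM (𝕜 := ℂ)
        (spectral (fun z => ((‖u z‖ ^ 2 : ℝ) : ℂ)) (conjDiag U d)) w⟫_ℂ := by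
  have h1 := inner_self_eq_norm_sq_to_K (𝕜 := ℂ)
    (Matrix.toEuclideanCLM (𝕜 := ℂ) (spectral u (conjDiag U d)) w)
  push_cast
  refine h1.symm.trans ?_
  rw [← inner_toEuclideanCLM_star, ← toEuclideanCLM_mul_apply, star_spectral_conjDiag,
    spectral_mul_conjDiag]
  simp only [Complex.conj_mul']

/-- Since ‖u^#(Z) w‖² = ⟨w, (|u|²)^#(Z) w⟩, square integrability reduces to integrability of |u|² on
ℂ. -/
theorem memLp_spectral_apply {u : ℂ → ℂ} (hu : Continuous u) {h : Planck}
    (hL : MemLp u 2 (gaussian h)) (w : EuclideanSpace ℂ (Fin N)) :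
    MemLp (fun Z => Matrix.toEuclideanCLM (𝕜 := ℂ) (spectral u Z) w) 2 (normalMeasure N h) := by
  rw [memLp_two_iff_integrable_sq_norm
    (aestronglyMeasurable_spectral_apply hu h aestronglyMeasurable_const)]
  have h1 : Integrable (fun z => ((‖u z‖ ^ 2 : ℝ) : ℂ)) (gaussian h) :=
    ((memLp_two_iff_integrable_sq_norm hL.1).1 hL).ofReal
  have h2 := (integrable_inner_spectral (N := N) (by fun_prop) h1 w w).1.re
  refine h2.congr (ae_normalMeasure h fun U d => ?_)
  beta_reduce
  rw [← norm_spectral_apply_sq]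
  exact Complex.ofReal_re _

theorem norm_spectral_le {u : ℂ → ℂ} {M : ℝ} (hM : 0 ≤ M) (hu : ∀ z, ‖u z‖ ≤ M)
    (Z : NormalMatrix N) : ‖spectral u Z‖ ≤ M := by
  rw [spectral]
  split_ifs with hZ
  · rw [CStarRing.norm_mul_mem_unitary _ (Unitary.star_mem hZ.choose.1.2),
      CStarRing.norm_coe_unitary_mul, Matrix.l2_opNorm_diagonal]
    exact (pi_norm_le_iff_of_nonneg hM).2 fun i => hu _
  -- The default value 0 of `spectral` also obeys the bound, so it holds at every Z without
  -- diagonalizing Z.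
  · rwa [norm_zero]

end NormalMatrices

/-! ### Kernel functions on normal matrices -/

section NormalMatrices

open scoped Matrix.Norms.L2Operator

variable {N : ℕ}

theorem coeFn_kernelVec (h : Planck) (X : NormalMatrix N) (χ : EuclideanSpace ℂ (Fin N)) :
    ((kernelVec h X χ : normalSpace N h) : Lp (EuclideanSpace ℂ (Fin N)) 2 (normalMeasure N h))
      =ᵐ[normalMeasure N h] kernelFun h X χ := (memLp_kernelFun h X χ).coeFn_toLp

theorem conjDiag_pow (U : Matrix.unitaryGroup (Fin N) ℂ) (d : Fin N → ℂ) (k : ℕ) :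
    (conjDiag U d).1 ^ k = spectral (fun z => z ^ k) (conjDiag U d) := by
  induction k with
  | zero =>
    rw [spectral_conjDiag, show ((fun z : ℂ => z ^ 0) ∘ d) = 1 by funext j; simp,
      Matrix.diagonal_one', mul_one, pow_zero, Unitary.coe_star_mul_self]
  | succ k ih =>
    have h1 : (conjDiag U d).1 = spectral (fun z => z) (conjDiag U d) := by
      rw [spectral_conjDiag]; rfl
    rw [pow_succ, ih]
    rw [h1, spectral_mul_conjDiag]
    simp only [pow_succ]

/-- At Y = xI the powers of Y⋆ are scalars, so the kernel is the power series of z ↦ exp(z x̄/h)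
evaluated at Z. -/
theorem normalKernel_scalarMatrix (h : Planck) (x : ℂ) (U : Matrix.unitaryGroup (Fin N) ℂ)
    (d : Fin N → ℂ) : normalKernel h (conjDiag U d) (scalarMatrix N x) =
      spectral (scalarKernel h x) (conjDiag U d) := by
  have h1 : ∀ z : ℂ, HasSum (fun k : ℕ => (((k.factorial : ℝ) * (h : ℝ) ^ k : ℝ) : ℂ)⁻¹ *
      starRingEnd ℂ x ^ k * z ^ k) (scalarKernel h x z) := fun z => by
    have h2 := NormedSpace.expSeries_div_hasSum_exp (z * starRingEnd ℂ x / (h : ℝ))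
    rw [← Complex.exp_eq_exp_ℂ] at h2
    refine h2.congr_fun fun k => ?_
    rw [div_pow, mul_pow]
    push_cast
    field_simp
  have h3 : HasSum (fun k : ℕ => fun j => (((k.factorial : ℝ) * (h : ℝ) ^ k : ℝ) : ℂ)⁻¹ *
      starRingEnd ℂ x ^ k * (d j) ^ k) (scalarKernel h x ∘ d) := Pi.hasSum.2 fun j => h1 (d j)
  have h4 := (h3.matrix_diagonal.mul_left (star U.1)).mul_right U.1
  rw [spectral_conjDiag, normalKernel]
  refine Eq.trans (tsum_congr fun k => ?_) h4.tsum_eq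
  rw [kernelTerm, conjDiag_pow, spectral_conjDiag, scalarMatrix, Matrix.conjTranspose_smul,
    Matrix.conjTranspose_one, smul_pow, one_pow, mul_smul_comm, mul_one, smul_smul,
    ← smul_mul_assoc, ← mul_smul_comm, ← Matrix.diagonal_smul]
  rfl

theorem scalarMatrix_eq_conjDiag (x : ℂ) :
    scalarMatrix N x = conjDiag (1 : Matrix.unitaryGroup (Fin N) ℂ) fun _ => x := by
  refine Subtype.ext ?_
  simp [scalarMatrix, conjDiag, Matrix.smul_one_eq_diagonal]

theorem spectral_scalarMatrix (f : ℂ → ℂ) (x : ℂ) :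
    spectral f (scalarMatrix N x) = f x • (1 : Matrix (Fin N) (Fin N) ℂ) := by
  rw [scalarMatrix_eq_conjDiag, spectral_conjDiag, Matrix.smul_one_eq_diagonal]
  simp

theorem normalKernel_scalarMatrix_self (h : Planck) (x : ℂ) :
    normalKernel h (scalarMatrix N x) (scalarMatrix N x) =
      ((Real.exp (‖x‖ ^ 2 / h) : ℝ) : ℂ) • (1 : Matrix (Fin N) (Fin N) ℂ) := by
  have h1 := normalKernel_scalarMatrix h x (1 : Matrix.unitaryGroup (Fin N) ℂ) fun _ => x
  rw [← scalarMatrix_eq_conjDiag, spectral_scalarMatrix] at h1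
  rw [h1, scalarKernel, Complex.mul_conj']
  push_cast
  rfl

/-! ### Orthogonality of monomials and norms of kernel functions -/

/-- The product (Z^k)⋆ Z^m is the spectral function of z̄^k z^m, so only scalar moments remain. -/
theorem inner_monomial (h : Planck) (k m : ℕ) (v w : EuclideanSpace ℂ (Fin N)) :
    ⟪(memLp_monomial h k v).toLp (monomial k v), (memLp_monomial h m w).toLp (monomial m w)⟫_ℂ =
      (∫ z, starRingEnd ℂ z ^ k * z ^ m ∂(gaussian h)) * ⟪v, w⟫_ℂ := by
  have hi : Integrable (fun z : ℂ => starRingEnd ℂ z ^ k * z ^ m) (gaussian h) :=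
    (integrable_pow_gaussian h (k + m)).mono' (Continuous.aestronglyMeasurable (by fun_prop))
      (ae_of_all _ fun z => by simp [pow_add])
  rw [← (integrable_inner_spectral (by fun_prop) hi v w).2, L2.inner_def]
  refine integral_congr_ae ?_
  filter_upwards [(memLp_monomial h k v).coeFn_toLp, (memLp_monomial h m w).coeFn_toLp,
    ae_normalMeasure (p := fun Z => star (Z.1 ^ k) * Z.1 ^ m =
      spectral (fun z => starRingEnd ℂ z ^ k * z ^ m) Z) h fun U d => by
        rw [conjDiag_pow, conjDiag_pow, star_spectral_conjDiag, spectral_mul_conjDiag]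
        simp only [map_pow]] with Z h1 h2 h3
  rw [h1, h2, monomial, monomial, ← inner_toEuclideanCLM_star, ← toEuclideanCLM_mul_apply, h3]

/-- The coefficient of `Z ^ k` in `K_h(Z, X) χ`. -/
def kernelCoeff (h : Planck) (X : NormalMatrix N) (χ : EuclideanSpace ℂ (Fin N)) (k : ℕ) :
    EuclideanSpace ℂ (Fin N) :=
  ((((k.factorial : ℝ) * (h : ℝ) ^ k : ℝ) : ℂ)⁻¹) • Matrix.toEuclideanCLM (𝕜 := ℂ) (X.1ᴴ ^ k) χ

theorem kernelTerm_apply (h : Planck) (X Z : NormalMatrix N) (χ : EuclideanSpace ℂ (Fin N))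
    (k : ℕ) : Matrix.toEuclideanCLM (𝕜 := ℂ) (kernelTerm h Z.1 X.1 k) χ =
      monomial k (kernelCoeff h X χ k) Z := by
  rw [kernelTerm, monomial, kernelCoeff, map_smul, map_smul, smul_apply,
    toEuclideanCLM_mul_apply]

/-- Cross terms vanish by orthogonality, and the moment k! h^k cancels one of the two coefficients
1/(k! h^k). -/
theorem norm_sum_kernelCoeff_sq (h : Planck) (X : NormalMatrix N) (χ : EuclideanSpace ℂ (Fin N))
    (n : ℕ) :
    ‖∑ k ∈ Finset.range n, (memLp_monomial h k (kernelCoeff h X χ k)).toLp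
      (monomial k (kernelCoeff h X χ k))‖ ^ 2 =
    (⟪χ, Matrix.toEuclideanCLM (𝕜 := ℂ)
      (∑ k ∈ Finset.range n, kernelTerm h X.1 X.1 k) χ⟫_ℂ).re := by
  have h1 := inner_self_eq_norm_sq_to_K (𝕜 := ℂ) (∑ k ∈ Finset.range n,
    (memLp_monomial h k (kernelCoeff h X χ k)).toLp (monomial k (kernelCoeff h X χ k)))
  have hh : (h : ℝ) ≠ 0 := h.2.ne'
  rw [sum_inner] at h1
  have h2 : ∀ k ∈ Finset.range n, ⟪(memLp_monomial h k (kernelCoeff h X χ k)).toLp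
      (monomial k (kernelCoeff h X χ k)), ∑ m ∈ Finset.range n,
      (memLp_monomial h m (kernelCoeff h X χ m)).toLp (monomial m (kernelCoeff h X χ m))⟫_ℂ =
      ⟪χ, Matrix.toEuclideanCLM (𝕜 := ℂ) (kernelTerm h X.1 X.1 k) χ⟫_ℂ := fun k hk => by
    rw [inner_sum, Finset.sum_eq_single_of_mem k hk fun m _ hm => by
      rw [inner_monomial, integral_conj_pow_mul_pow_of_ne h hm.symm, zero_mul],
      inner_monomial, integral_conj_pow_mul_pow, kernelTerm_apply, monomial]
    have h3 : X.1 ^ k = star (X.1ᴴ ^ k) := by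
      rw [Matrix.star_eq_conjTranspose, Matrix.conjTranspose_pow, Matrix.conjTranspose_conjTranspose]
    rw [h3, inner_toEuclideanCLM_star]
    nth_rewrite 1 [kernelCoeff]
    rw [inner_smul_left, ← mul_assoc, map_inv₀, Complex.conj_ofReal, mul_inv_cancel₀, one_mul]
    exact Complex.ofReal_ne_zero.2 (by positivity)
  rw [Finset.sum_congr rfl h2, ← inner_sum] at h1
  rw [map_sum, sum_apply, h1]
  simp [← Complex.ofReal_pow]

/-- Fatou's lemma applied to the partial sums of the kernel series. This one-sided bound replaces
the reproducing property, which is never needed. -/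
theorem norm_kernelVec_sq_le (h : Planck) (X : NormalMatrix N) (χ : EuclideanSpace ℂ (Fin N)) :
    ‖kernelVec h X χ‖ ^ 2 ≤
      (⟪χ, Matrix.toEuclideanCLM (𝕜 := ℂ) (normalKernel h X X) χ⟫_ℂ).re := by
  set r : ℕ → ℝ := fun n => (⟪χ, Matrix.toEuclideanCLM (𝕜 := ℂ)
      (∑ k ∈ Finset.range n, kernelTerm h X.1 X.1 k) χ⟫_ℂ).re with hr
  set r₀ : ℝ := (⟪χ, Matrix.toEuclideanCLM (𝕜 := ℂ) (normalKernel h X X) χ⟫_ℂ).re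
  have hS : ∀ Z : NormalMatrix N, Tendsto (fun n => Matrix.toEuclideanCLM (𝕜 := ℂ)
      (∑ k ∈ Finset.range n, kernelTerm h Z.1 X.1 k) χ) atTop (𝓝 (kernelFun h X χ Z)) := fun Z =>
    ((continuous_toEuclideanCLM χ).tendsto _).comp
      (summable_kernelTerm h Z.1 X.1).hasSum.tendsto_sum_nat
  have hlim : Tendsto r atTop (𝓝 r₀) :=
    (Complex.continuous_re.tendsto _).comp (tendsto_const_nhds.inner (hS X))
  have hr0 : ∀ n, 0 ≤ r n := fun n => by
    rw [hr]; beta_reduce; rw [← norm_sum_kernelCoeff_sq]; positivity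
  have hr₀ : 0 ≤ r₀ := ge_of_tendsto' hlim hr0
  have hnorm : ∀ n, eLpNorm (fun Z : NormalMatrix N => Matrix.toEuclideanCLM (𝕜 := ℂ)
      (∑ k ∈ Finset.range n, kernelTerm h Z.1 X.1 k) χ) 2 (normalMeasure N h) =
      ENNReal.ofReal (√(r n)) := fun n => by
    have h1 : √(r n) = ‖∑ k ∈ Finset.range n, (memLp_monomial h k (kernelCoeff h X χ k)).toLp
      (monomial k (kernelCoeff h X χ k))‖ := by
      rw [hr]; beta_reduce; rw [← norm_sum_kernelCoeff_sq, Real.sqrt_sq (norm_nonneg _)]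
    rw [h1, Lp.norm_def, ENNReal.ofReal_toReal (Lp.eLpNorm_ne_top _)]
    refine eLpNorm_congr_ae ?_
    have h2 : ∀ k, _ =ᵐ[normalMeasure N h] monomial k (kernelCoeff h X χ k) := fun k =>
      (memLp_monomial h k (kernelCoeff h X χ k)).coeFn_toLp
    filter_upwards [ae_all_iff.2 h2, Lp.coeFn_fun_finsetSum (Finset.range n) fun k =>
      (memLp_monomial h k (kernelCoeff h X χ k)).toLp
      (monomial k (kernelCoeff h X χ k))] with Z hZ hZ'
    rw [hZ', map_sum, sum_apply]
    exact Finset.sum_congr rfl fun k _ => by rw [hZ k, kernelTerm_apply]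
  have hF := Lp.eLpNorm_lim_le_liminf_eLpNorm (p := 2) (μ := normalMeasure N h)
    (fun n => ((continuous_toEuclideanCLM χ).comp
      (continuous_kernelSum h X n)).aestronglyMeasurable) (kernelFun h X χ)
    (ae_of_all _ fun Z => hS Z)
  have hlim' : Tendsto (fun n => ENNReal.ofReal (√(r n))) atTop (𝓝 (ENNReal.ofReal (√r₀))) :=
    ENNReal.tendsto_ofReal ((Real.continuous_sqrt.tendsto _).comp hlim)
  replace hF := hF.trans_eq (congrArg (fun u => liminf u atTop) (funext hnorm))
  rw [hlim'.liminf_eq] at hF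
  have h3 : ‖kernelVec h X χ‖ ≤ √r₀ := by
    refine (Lp.norm_toLp _ (memLp_kernelFun h X χ)).trans_le ?_
    exact ENNReal.toReal_le_of_le_ofReal (Real.sqrt_nonneg _) hF
  calc _ ≤ √r₀ ^ 2 := by gcongr
    _ = r₀ := Real.sq_sqrt hr₀

/-- The map `χ ↦ K_{X, χ}` is linear. -/
def kernelVecLinear (h : Planck) (X : NormalMatrix N) :
    EuclideanSpace ℂ (Fin N) →ₗ[ℂ] normalSpace N h where
  toFun := kernelVec h X
  map_add' v w := by
    refine Subtype.ext ?_
    rw [Submodule.coe_add]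
    simp only [kernelVec]
    rw [← MemLp.toLp_add, MemLp.toLp_eq_toLp_iff]
    exact ae_of_all _ fun Z => by simp [kernelFun]
  map_smul' c v := by
    refine Subtype.ext ?_
    rw [RingHom.id_apply, Submodule.coe_smul]
    simp only [kernelVec]
    rw [← MemLp.toLp_const_smul, MemLp.toLp_eq_toLp_iff]
    exact ae_of_all _ fun Z => by simp [kernelFun]

theorem kernelVec_eq_sum (h : Planck) (X : NormalMatrix N) (χ : EuclideanSpace ℂ (Fin N)) :
    kernelVec h X χ = ∑ j, χ j • kernelVec h X (EuclideanSpace.single j 1) := by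
  have h1 := (EuclideanSpace.basisFun (Fin N) ℂ).sum_repr χ
  have h2 := congrArg (kernelVecLinear h X) h1
  rw [map_sum] at h2
  refine h2.symm.trans (Finset.sum_congr rfl fun j _ => ?_)
  rw [map_smul, EuclideanSpace.basisFun_apply, EuclideanSpace.basisFun_repr]
  rfl

theorem inner_preBerezin {h : Planck} {T : normalSpace N h →ₗ.[ℂ] normalSpace N h}
    {X : NormalMatrix N} (hT : ∀ χ, kernelVec h X χ ∈ T.domain)
    (v w : EuclideanSpace ℂ (Fin N)) :
    ⟪v, Matrix.toEuclideanCLM (𝕜 := ℂ) (preBerezin T X) w⟫_ℂ =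
      pairing T (kernelVec h X w) (kernelVec h X v) := by
  rw [kernelVec_eq_sum h X w, kernelVec_eq_sum h X v, pairing_sum_smul _ _ _ fun j => hT _,
    PiLp.inner_apply]
  refine Finset.sum_congr rfl fun i _ => ?_
  rw [Matrix.ofLp_toEuclideanCLM, Matrix.mulVec_eq_sum, ← Finset.mul_sum, RCLike.inner_apply,
    mul_comm]
  congr 1
  rw [Finset.sum_apply]
  exact Finset.sum_congr rfl fun j _ => by simp [preBerezin, mul_comm]

end NormalMatrices

/-! ### Domains and norm bounds -/

section NormalMatrices

open scoped Matrix.Norms.L2Operator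

variable {N : ℕ}

theorem kernelVec_mem_domain_iff (h : Planck) (f : ℂ → ℂ) (X : NormalMatrix N)
    (χ : EuclideanSpace ℂ (Fin N)) :
    kernelVec h X χ ∈ (normalToeplitz h (spectral (N := N) f)).domain ↔
      MemLp (fun Z => Matrix.toEuclideanCLM (𝕜 := ℂ) (spectral f Z) (kernelFun h X χ Z)) 2
        (normalMeasure N h) :=
  mem_toeplitz_domain_of_ae_eq (coeFn_kernelVec h X χ)

theorem norm_kernelFun_le (h : Planck) (X : NormalMatrix N) (χ : EuclideanSpace ℂ (Fin N))
    (Z : NormalMatrix N) :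
    ‖kernelFun h X χ Z‖ ≤ Real.exp (2 * (‖X.1‖ / h) * ‖Z.1‖) * ‖χ‖ := by
  have h1 := norm_kernel_sub_le h Z X 0
  simp only [Finset.range_zero, Finset.sum_empty, sub_zero, pow_zero, one_mul] at h1
  refine (norm_toEuclideanCLM_le _ χ).trans ?_
  gcongr
  exact h1.trans_eq (by congr 1; ring)

theorem norm_spectral_conjDiag_sq_le (f : ℂ → ℂ) (U : Matrix.unitaryGroup (Fin N) ℂ)
    (d : Fin N → ℂ) : ‖spectral f (conjDiag U d)‖ ^ 2 ≤ ∑ j, ‖f (d j)‖ ^ 2 := by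
  have h1 : ‖spectral f (conjDiag U d)‖ = ‖f ∘ d‖ := by
    rw [spectral_conjDiag]
    exact norm_conjDiag U (f ∘ d)
  have h2 : ‖f ∘ d‖ ≤ √(∑ j, ‖f (d j)‖ ^ 2) := by
    refine (pi_norm_le_iff_of_nonneg (Real.sqrt_nonneg _)).2 fun i => ?_
    refine Real.le_sqrt_of_sq_le ?_
    exact Finset.single_le_sum (f := fun j => ‖f (d j)‖ ^ 2) (fun j _ => by positivity)
      (Finset.mem_univ i)
  rw [h1]
  calc _ ≤ √(∑ j, ‖f (d j)‖ ^ 2) ^ 2 := by gcongr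
    _ = _ := Real.sq_sqrt (by positivity)

theorem kernelVec_mem_domain {f : ℂ → ℂ} {h h₀ : Planck} (hf : Continuous f) (hh₀ : h < h₀)
    (hL : MemLp f 2 (gaussian h₀)) (X : NormalMatrix N) (χ : EuclideanSpace ℂ (Fin N)) :
    kernelVec h X χ ∈ (normalToeplitz h (spectral (N := N) f)).domain := by
  have hm := aestronglyMeasurable_spectral_apply hf h (memLp_kernelFun h X χ).1
  have hh : (0 : ℝ) < h := h.2
  rw [kernelVec_mem_domain_iff, memLp_two_iff_integrable_sq_norm hm]
  have hm2 := hm.norm.pow 2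
  -- The inner 2 comes from the growth bound for the kernel, the outer one from squaring.
  set a : ℝ := 2 * (2 * (‖X.1‖ / h)) with ha
  have ha0 : 0 ≤ a := by positivity
  -- With ‖f^#(Z)‖² ≤ ∑ⱼ |f(dⱼ)|² and ‖d‖ ≤ ∑ᵢ |dᵢ|, the majorant is a sum of products of
  -- one-variable functions; in the j-th product only the j-th factor carries |f|².
  have h1 : ∀ j : Fin N, Integrable
      (fun d : Fin N → ℂ => ∏ i, (if i = j then ‖f (d i)‖ ^ 2 else 1) * Real.exp (a * ‖d i‖))
      (Measure.pi fun _ : Fin N => gaussian h) := fun j => by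
    refine Integrable.fintype_prod
      (f := fun i z => (if i = j then ‖f z‖ ^ 2 else 1) * Real.exp (a * ‖z‖)) fun i => ?_
    by_cases hij : i = j
    · simpa only [hij, if_true] using integrable_sq_mul_exp_gaussian hf hh₀ hL a
    · simpa only [hij, if_false, one_mul] using integrable_exp_norm h a
  have h2 := ((integrable_finsetSum Finset.univ fun j _ => h1 j).mul_const
    (‖χ‖ ^ 2)).comp_snd (unitaryHaar N)
  unfold normalMeasure at hm2 ⊢
  refine (integrable_map_measure hm2 (continuous_conjDiag N).aemeasurable).2 ?_
  refine h2.mono' (hm2.comp_aemeasurable (continuous_conjDiag N).aemeasurable)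
    (ae_of_all _ fun p => ?_)
  have h3 : ∀ j, ∏ i, (if i = j then ‖f (p.2 i)‖ ^ 2 else 1) * Real.exp (a * ‖p.2 i‖) =
      ‖f (p.2 j)‖ ^ 2 * Real.exp (a * ∑ i, ‖p.2 i‖) := fun j => by
    rw [Finset.prod_mul_distrib, Finset.prod_ite_eq' Finset.univ j fun i => ‖f (p.2 i)‖ ^ 2,
      if_pos (Finset.mem_univ j), ← Real.exp_sum, Finset.mul_sum]
  have h4 : ‖p.2‖ ≤ ∑ i, ‖p.2 i‖ := (pi_norm_le_iff_of_nonneg (by positivity)).2 fun i =>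
    Finset.single_le_sum (f := fun i => ‖p.2 i‖) (fun i _ => norm_nonneg _) (Finset.mem_univ i)
  simp only [h3, Function.comp_apply, Pi.pow_apply]
  rw [← Finset.sum_mul, Real.norm_of_nonneg (by positivity)]
  calc _ ≤ (‖spectral f (conjDiag p.1 p.2)‖ * (Real.exp (2 * (‖X.1‖ / h) * ‖p.2‖) * ‖χ‖)) ^ 2 := by
        gcongr
        refine (norm_toEuclideanCLM_le _ _).trans ?_
        gcongr
        exact (norm_kernelFun_le h X χ _).trans_eq (by rw [norm_conjDiag])
    _ = ‖spectral f (conjDiag p.1 p.2)‖ ^ 2 * Real.exp (a * ‖p.2‖) * ‖χ‖ ^ 2 := by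
        rw [mul_pow, mul_pow, ← Real.exp_nat_mul, ← mul_assoc]
        congr 3
        rw [ha]; push_cast; ring
    _ ≤ _ := by
        gcongr
        exact norm_spectral_conjDiag_sq_le f p.1 p.2

/-! ### Normalization by the inverse square root of the kernel -/

theorem isSelfAdjoint_normalKernel (h : Planck) (X : NormalMatrix N) :
    IsSelfAdjoint (normalKernel h X X) := by
  rw [IsSelfAdjoint, normalKernel, tsum_star]
  refine tsum_congr fun k => ?_
  rw [kernelTerm, star_smul, star_mul, star_pow, star_pow, ← Matrix.star_eq_conjTranspose,
    star_star, star_inv₀]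
  congr 2
  exact Complex.conj_ofReal _

theorem isSelfAdjoint_invSqrt (A : Matrix (Fin N) (Fin N) ℂ) : IsSelfAdjoint (invSqrt A) :=
  cfc_predicate _ A

theorem inv_sqrt_mul_mul_inv_sqrt {t : ℝ} (ht : 0 < t) : (√t)⁻¹ * t * (√t)⁻¹ = 1 := by
  rw [mul_right_comm, ← mul_inv, Real.mul_self_sqrt ht.le, inv_mul_cancel₀ ht.ne']

theorem inner_invSqrt_apply (A B : Matrix (Fin N) (Fin N) ℂ) (v w : EuclideanSpace ℂ (Fin N)) :
    ⟪Matrix.toEuclideanCLM (𝕜 := ℂ) (invSqrt A) v, Matrix.toEuclideanCLM (𝕜 := ℂ) B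
      (Matrix.toEuclideanCLM (𝕜 := ℂ) (invSqrt A) w)⟫_ℂ =
      ⟪v, Matrix.toEuclideanCLM (𝕜 := ℂ) (invSqrt A * B * invSqrt A) w⟫_ℂ := by
  rw [← inner_toEuclideanCLM_star, (isSelfAdjoint_invSqrt A).star_eq,
    toEuclideanCLM_mul_apply, toEuclideanCLM_mul_apply]

/-- The product is the functional calculus of t^{-1/2} · t · t^{-1/2}, which is 1 for t > 0. For t ≤
0 the conventions √t = 0 and 0⁻¹ = 0 give 0, so positivity of A is not required. -/
theorem norm_invSqrt_mul_mul_invSqrt_le {A : Matrix (Fin N) (Fin N) ℂ} (hA : IsSelfAdjoint A) :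
    ‖invSqrt A * A * invSqrt A‖ ≤ 1 := by
  have hfin : (spectrum ℝ A).Finite := Matrix.finite_real_spectrum
  have hc : ∀ g : ℝ → ℝ, ContinuousOn g (spectrum ℝ A) := fun g => hfin.continuousOn g
  have h1 : invSqrt A * A * invSqrt A = cfc (fun t : ℝ => (√t)⁻¹ * t * (√t)⁻¹) A := by
    rw [cfc_mul (fun t : ℝ => (√t)⁻¹ * t) (fun t : ℝ => (√t)⁻¹) A (hc _) (hc _),
      cfc_mul (fun t : ℝ => (√t)⁻¹) (fun t : ℝ => t) A (hc _) (hc _), cfc_id' ℝ A]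
    rfl
  rw [h1]
  refine norm_cfc_le zero_le_one fun t _ => ?_
  rcases le_or_gt t 0 with ht | ht
  · simp [Real.sqrt_eq_zero_of_nonpos ht]
  · simp [inv_sqrt_mul_mul_inv_sqrt ht]

theorem norm_kernelVec_invSqrt_le (h : Planck) (X : NormalMatrix N)
    (v : EuclideanSpace ℂ (Fin N)) :
    ‖kernelVec h X (Matrix.toEuclideanCLM (𝕜 := ℂ) (invSqrt (normalKernel h X X)) v)‖ ≤ ‖v‖ := by
  refine (pow_le_pow_iff_left₀ (norm_nonneg _) (norm_nonneg _) two_ne_zero).1 ?_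
  refine (norm_kernelVec_sq_le h X _).trans ?_
  rw [inner_invSqrt_apply]
  refine (Complex.re_le_norm _).trans ((norm_inner_le_norm _ _).trans ?_)
  have h1 := norm_invSqrt_mul_mul_invSqrt_le (isSelfAdjoint_normalKernel h X)
  calc _ ≤ ‖v‖ * (1 * ‖v‖) := by
        gcongr
        refine (norm_toEuclideanCLM_le _ v).trans ?_
        gcongr
    _ = _ := by ring

/-- With K = K(X, X), the form ⟨v, T̃(X) w⟩ equals ⟨T K_{X, K^{-1/2} w}, K_{X, K^{-1/2} v}⟩, whose
kernel vectors have norms at most ‖w‖ and ‖v‖. The choice v = T̃(X) w yields the operator norm. -/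
theorem norm_berezin_le {h : Planck} {T : normalSpace N h →ₗ.[ℂ] normalSpace N h}
    {X : NormalMatrix N} (hd : ∀ χ, kernelVec h X χ ∈ T.domain) {M : ℝ} (hM : 0 ≤ M)
    (hT : ∀ u : T.domain, ‖T u‖ ≤ M * ‖u‖) : ‖berezin T X‖ ≤ M := by
  refine ContinuousLinearMap.opNorm_le_bound (Matrix.toEuclideanCLM (𝕜 := ℂ) (berezin T X)) hM
    fun w => ?_
  set v := Matrix.toEuclideanCLM (𝕜 := ℂ) (berezin T X) w with hv
  have h1 : ⟪v, v⟫_ℂ = pairing T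
      (kernelVec h X (Matrix.toEuclideanCLM (𝕜 := ℂ) (invSqrt (normalKernel h X X)) w))
      (kernelVec h X (Matrix.toEuclideanCLM (𝕜 := ℂ) (invSqrt (normalKernel h X X)) v)) := by
    rw [← inner_preBerezin hd, inner_invSqrt_apply]
    rfl
  have h2 : ‖v‖ * ‖v‖ ≤ M * ‖w‖ * ‖v‖ := by
    have h3 := norm_pairing_le hM hT
      (kernelVec h X (Matrix.toEuclideanCLM (𝕜 := ℂ) (invSqrt (normalKernel h X X)) w))
      (kernelVec h X (Matrix.toEuclideanCLM (𝕜 := ℂ) (invSqrt (normalKernel h X X)) v))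
    rw [← h1, inner_self_eq_norm_sq_to_K, norm_pow, sq] at h3
    simp only [RCLike.norm_ofReal, abs_norm] at h3
    refine h3.trans ?_
    gcongr
    · exact norm_kernelVec_invSqrt_le h X w
    · exact norm_kernelVec_invSqrt_le h X v
  rcases (norm_nonneg v).eq_or_lt with h0 | h0
  · rw [← h0]; positivity
  · exact le_of_mul_le_mul_right h2 h0

/-! ### The Berezin transform at scalar matrices -/

theorem kernelFun_scalarMatrix_conjDiag (h : Planck) (x : ℂ) (χ : EuclideanSpace ℂ (Fin N))
    (U : Matrix.unitaryGroup (Fin N) ℂ) (d : Fin N → ℂ) :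
    kernelFun h (scalarMatrix N x) χ (conjDiag U d) =
      Matrix.toEuclideanCLM (𝕜 := ℂ) (spectral (scalarKernel h x) (conjDiag U d)) χ := by
  rw [kernelFun, normalKernel_scalarMatrix]

theorem kernelVec_scalarMatrix_mem_domain {h : Planck} {f : ℂ → ℂ} (hf : Continuous f) {x : ℂ}
    (hx : scalarKernelVec h x ∈ (scalarToeplitz h f).domain) (χ : EuclideanSpace ℂ (Fin N)) :
    kernelVec h (scalarMatrix N x) χ ∈ (normalToeplitz h (spectral (N := N) f)).domain := by
  rw [kernelVec_mem_domain_iff]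
  refine (memLp_spectral_apply (hf.mul (differentiable_scalarKernel h x).continuous)
    ((scalarKernelVec_mem_domain_iff h f x).1 hx) χ).ae_eq (ae_normalMeasure h fun U d => ?_)
  beta_reduce
  rw [kernelFun_scalarMatrix_conjDiag, ← toEuclideanCLM_mul_apply, spectral_mul_conjDiag]
  rfl

theorem preBerezin_scalarMatrix {h : Planck} {f : ℂ → ℂ} (hf : Continuous f) {x : ℂ}
    (hx : scalarKernelVec h x ∈ (scalarToeplitz h f).domain) :
    preBerezin (normalToeplitz h (spectral (N := N) f)) (scalarMatrix N x) =
      ((Real.exp (‖x‖ ^ 2 / h) : ℝ) * scalarBerezin (scalarToeplitz h f) x) •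
        (1 : Matrix (Fin N) (Fin N) ℂ) := by
  have hk := (differentiable_scalarKernel h x).continuous
  have hi : Integrable (fun z => f z * (‖scalarKernel h x z‖ ^ 2 : ℝ)) (gaussian h) := by
    have h2 := ((scalarKernelVec_mem_domain_iff h f x).1 hx).integrable_mul
      (memLp_scalarKernel h x).star
    refine h2.congr (ae_of_all _ fun z => ?_)
    simp only [Pi.mul_apply, Pi.star_apply, RCLike.star_def]
    rw [mul_assoc, Complex.mul_conj']
    push_cast; ring
  rw [scalarBerezin_eq h hx, ← integral_mul_norm_scalarKernel_sq]
  ext i j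
  have h1 := (integrable_inner_spectral (N := N) (by fun_prop) hi (EuclideanSpace.single i 1)
    (EuclideanSpace.single j 1)).2
  have h3 : ⟪(EuclideanSpace.single i 1 : EuclideanSpace ℂ (Fin N)),
      EuclideanSpace.single j 1⟫_ℂ = (1 : Matrix (Fin N) (Fin N) ℂ) i j := by
    rw [EuclideanSpace.inner_single_left, Matrix.one_apply]
    simp
  rw [Matrix.smul_apply, ← h3, smul_eq_mul, ← h1, preBerezin, Matrix.of_apply, normalToeplitz,
    pairing_toeplitz (kernelVec_scalarMatrix_mem_domain hf hx _) _ (coeFn_kernelVec h _ _)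
      (coeFn_kernelVec h _ _)]
  -- On U⋆ diag(d) U, the product K_x^#⋆ f^# K_x^# is the spectral function of f |K_x|².
  refine integral_congr_ae (ae_normalMeasure h fun U d => ?_)
  beta_reduce
  rw [kernelFun_scalarMatrix_conjDiag, kernelFun_scalarMatrix_conjDiag,
    ← inner_toEuclideanCLM_star, ← toEuclideanCLM_mul_apply, ← toEuclideanCLM_mul_apply,
    star_spectral_conjDiag, spectral_mul_conjDiag, spectral_mul_conjDiag]
  congr 4
  funext z
  have := Complex.conj_mul' (scalarKernel h x z)
  push_cast
  linear_combination f z * this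

theorem invSqrt_smul_one {t : ℝ} :
    invSqrt ((t : ℂ) • (1 : Matrix (Fin N) (Fin N) ℂ)) =
      (((√t)⁻¹ : ℝ) : ℂ) • (1 : Matrix (Fin N) (Fin N) ℂ) := by
  have h1 : ∀ s : ℝ, algebraMap ℝ (Matrix (Fin N) (Fin N) ℂ) s = (s : ℂ) • 1 := fun s => by
    rw [Algebra.algebraMap_eq_smul_one, ← Complex.coe_smul]
  rw [← h1, ← h1, invSqrt, cfc_algebraMap]

theorem berezin_scalarMatrix {h : Planck} {f : ℂ → ℂ} (hf : Continuous f) {x : ℂ}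
    (hx : scalarKernelVec h x ∈ (scalarToeplitz h f).domain) :
    berezin (normalToeplitz h (spectral (N := N) f)) (scalarMatrix N x) =
      scalarBerezin (scalarToeplitz h f) x • (1 : Matrix (Fin N) (Fin N) ℂ) := by
  rw [berezin, preBerezin_scalarMatrix hf hx, normalKernel_scalarMatrix_self, invSqrt_smul_one,
    smul_mul_assoc, one_mul, smul_smul, smul_mul_smul_comm, one_mul]
  congr 1
  set t := Real.exp (‖x‖ ^ 2 / h)
  have h1 := inv_sqrt_mul_mul_inv_sqrt (Real.exp_pos (‖x‖ ^ 2 / h))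
  have h2 := congrArg (fun s : ℝ => (s : ℂ)) h1
  simp only [Complex.ofReal_mul, Complex.ofReal_one] at h2
  linear_combination scalarBerezin (scalarToeplitz h f) x * h2

/-- The test vector K_{xI, v}, with v = K(xI, xI)^{-1/2} e for a unit vector e, has norm at most 1,
and T_φ pairs it with itself to T̃_f(x). This applies to unbounded T_φ as well. -/
theorem enorm_scalarBerezin_le_opENorm (hN : 0 < N) {h : Planck} {f : ℂ → ℂ} (hf : Continuous f)
    {x : ℂ} (hx : scalarKernelVec h x ∈ (scalarToeplitz h f).domain) :
    ‖scalarBerezin (scalarToeplitz h f) x‖ₑ ≤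
      opENorm (normalToeplitz h (spectral (N := N) f)) := by
  set T := normalToeplitz h (spectral (N := N) f)
  set i : Fin N := ⟨0, hN⟩
  set e : EuclideanSpace ℂ (Fin N) := EuclideanSpace.single i 1 with he
  set v := Matrix.toEuclideanCLM (𝕜 := ℂ)
    (invSqrt (normalKernel h (scalarMatrix N x) (scalarMatrix N x))) e with hv
  have he1 : ‖e‖ = 1 := by simp [he]
  have h1 : ‖kernelVec h (scalarMatrix N x) v‖ ≤ 1 :=
    (norm_kernelVec_invSqrt_le h (scalarMatrix N x) e).trans_eq he1
  have h2 : pairing T (kernelVec h (scalarMatrix N x) v) (kernelVec h (scalarMatrix N x) v) =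
      scalarBerezin (scalarToeplitz h f) x := by
    rw [← inner_preBerezin fun χ => kernelVec_scalarMatrix_mem_domain hf hx χ, hv,
      inner_invSqrt_apply, ← berezin,
      berezin_scalarMatrix hf hx, map_smul, map_one, smul_apply, inner_smul_right]
    simp [he1]
  rw [← h2]
  exact enorm_pairing_le_opENorm T h1

/-! ### The semiclassical limit -/

theorem enorm_toEuclideanCLM_smul_one (hN : 0 < N) (c : ℂ) :
    ‖Matrix.toEuclideanCLM (𝕜 := ℂ) (c • (1 : Matrix (Fin N) (Fin N) ℂ))‖ₑ = ‖c‖ₑ := by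
  have : Nonempty (Fin N) := ⟨⟨0, hN⟩⟩
  rw [map_smul, map_one, enorm_smul, enorm_one, mul_one]

/-- The condition N > 0 ensures that the identity matrix has norm 1. -/
theorem enorm_le_supNorm (hN : 0 < N) {φ : NormalMatrix N → Matrix (Fin N) (Fin N) ℂ} {x c : ℂ}
    (hφ : φ (scalarMatrix N x) = c • 1) : ‖c‖ₑ ≤ supNorm φ := by
  rw [← enorm_toEuclideanCLM_smul_one hN c, ← hφ]
  exact le_iSup (fun Z => ‖Matrix.toEuclideanCLM (𝕜 := ℂ) (φ Z)‖ₑ) _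

theorem supNorm_spectral (hN : 0 < N) (f : ℂ → ℂ) :
    supNorm (spectral (N := N) f) = ⨆ z, ‖f z‖ₑ := by
  refine le_antisymm (iSup_le fun Z => ?_)
    (iSup_le fun z => enorm_le_supNorm hN (spectral_scalarMatrix f z))
  by_cases htop : ⨆ z, ‖f z‖ₑ = ⊤
  · rw [htop]; exact le_top
  · rw [← ofReal_norm, ← ENNReal.ofReal_toReal htop]
    refine ENNReal.ofReal_le_ofReal
      (norm_spectral_le ENNReal.toReal_nonneg (fun z => ?_) Z)
    rw [← toReal_enorm]
    exact ENNReal.toReal_mono htop (le_iSup (fun z => ‖f z‖ₑ) z)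

theorem norm_le_toReal_supNorm {φ : NormalMatrix N → Matrix (Fin N) (Fin N) ℂ}
    (hφ : supNorm φ ≠ ⊤) (Z : NormalMatrix N) :
    ‖Matrix.toEuclideanCLM (𝕜 := ℂ) (φ Z)‖ ≤ (supNorm φ).toReal := by
  rw [← toReal_enorm]
  exact ENNReal.toReal_mono hφ (le_iSup (fun Z => ‖Matrix.toEuclideanCLM (𝕜 := ℂ) (φ Z)‖ₑ) Z)

theorem norm_normalToeplitz_le {h : Planck} {φ : NormalMatrix N → Matrix (Fin N) (Fin N) ℂ}
    (hφ : supNorm φ ≠ ⊤) (u : (normalToeplitz h φ).domain) :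
    ‖normalToeplitz h φ u‖ ≤ (supNorm φ).toReal * ‖u‖ :=
  norm_toeplitz_le (H := normalSpace N h) (φ := fun Z => Matrix.toEuclideanCLM (𝕜 := ℂ) (φ Z))
    (norm_le_toReal_supNorm hφ) u

theorem opENorm_normalToeplitz_le (h : Planck) (φ : NormalMatrix N → Matrix (Fin N) (Fin N) ℂ) :
    opENorm (normalToeplitz h φ) ≤ supNorm φ := by
  by_cases hφ : supNorm φ = ⊤
  · rw [hφ]; exact le_top
  · refine (opENorm_le ENNReal.toReal_nonneg (norm_normalToeplitz_le hφ)).trans_eq (ENNReal.ofReal_toReal hφ)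

theorem supNorm_berezin_normalToeplitz_le {h : Planck}
    {φ : NormalMatrix N → Matrix (Fin N) (Fin N) ℂ}
    (hd : ∀ X χ, kernelVec h X χ ∈ (normalToeplitz h φ).domain) :
    supNorm (berezin (normalToeplitz h φ)) ≤ supNorm φ := by
  by_cases hφ : supNorm φ = ⊤
  · rw [hφ]; exact le_top
  · refine iSup_le fun X => ?_
    rw [← ofReal_norm, ← ENNReal.ofReal_toReal hφ]
    exact ENNReal.ofReal_le_ofReal (norm_berezin_le (hd X) ENNReal.toReal_nonneg
      (norm_normalToeplitz_le hφ))

/-- The common squeeze for both limits; F stands for the sup norm of the Berezin transform or for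
the operator norm. -/
theorem tendsto_supNorm_spectral (hN : 0 < N) {f : ℂ → ℂ} (hf : Continuous f) {h₀ : Planck}
    (hL : MemLp f 2 (gaussian h₀)) {F : Planck → ℝ≥0∞}
    (hle : ∀ h < h₀, F h ≤ supNorm (spectral (N := N) f))
    (hge : ∀ h < h₀, ∀ x, ‖scalarBerezin (scalarToeplitz h f) x‖ₑ ≤ F h) :
    Tendsto F hZero (𝓝 (supNorm (spectral (N := N) f))) := by
  have hlt := eventually_hZero_lt h₀
  refine tendsto_order.2 ⟨fun a ha => ?_, fun a ha => ?_⟩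
  · rw [supNorm_spectral hN] at ha
    -- A value below the supremum is exceeded by |f| at a single point x, so pointwise convergence
    -- there suffices, even if f is unbounded.
    obtain ⟨x, hx⟩ := lt_iSup_iff.1 ha
    have h1 : Tendsto (fun h => scalarBerezin (scalarToeplitz h f) x) hZero (𝓝 (f x)) := by
      refine (tendsto_integral_gaussian_smul hf hL x).congr' ?_
      filter_upwards [hlt] with h hh
      rw [scalarBerezin_eq h ((scalarKernelVec_mem_domain_iff h f x).2
        (memLp_mul_scalarKernel hf hh hL x))]
    filter_upwards [hlt, h1.enorm.eventually_const_lt hx] with h hh h2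
    exact h2.trans_le (hge h hh x)
  · filter_upwards [hlt] with h hh
    exact (hle h hh).trans_lt ha

end NormalMatrices

end BerezinToeplitz

end

theorem mainTheorem12 (N : ℕ) (hN : 0 < N) (f : ℂ → ℂ) (hf : Continuous f) :
    (∀ (h : Planck) (x : ℂ), scalarKernelVec h x ∈ (scalarToeplitz h f).domain →
      (∀ χ : EuclideanSpace ℂ (Fin N),
        kernelVec h (scalarMatrix N x) χ ∈ (normalToeplitz h (spectral (N := N) f)).domain) ∧
      berezin (normalToeplitz h (spectral (N := N) f)) (scalarMatrix N x) =
        scalarBerezin (scalarToeplitz h f) x • (1 : Matrix (Fin N) (Fin N) ℂ)) ∧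
    (∀ h₀ : Planck, MemLp f 2 (gaussian h₀) →
      (∀ h : Planck, h < h₀ →
        (∀ x : ℂ, scalarKernelVec h x ∈ (scalarToeplitz h f).domain) ∧
        (∀ (X : NormalMatrix N) (χ : EuclideanSpace ℂ (Fin N)),
          kernelVec h X χ ∈ (normalToeplitz h (spectral (N := N) f)).domain)) ∧
      Tendsto (fun h : Planck => supNorm (berezin (normalToeplitz h (spectral (N := N) f))))
        hZero (𝓝 (supNorm (spectral (N := N) f))) ∧
      Tendsto (fun h : Planck => opENorm (normalToeplitz h (spectral (N := N) f)))
        hZero (𝓝 (supNorm (spectral (N := N) f)))) := by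
  refine ⟨fun h x hx => ⟨kernelVec_scalarMatrix_mem_domain hf hx, berezin_scalarMatrix hf hx⟩,
    fun h₀ hL => ?_⟩
  have hs : ∀ h < h₀, ∀ x, scalarKernelVec h x ∈ (scalarToeplitz h f).domain := fun h hh x =>
    (scalarKernelVec_mem_domain_iff h f x).2 (memLp_mul_scalarKernel hf hh hL x)
  have hd : ∀ h < h₀, ∀ (X : NormalMatrix N) (χ : EuclideanSpace ℂ (Fin N)),
      kernelVec h X χ ∈ (normalToeplitz h (spectral (N := N) f)).domain := fun h hh =>
    kernelVec_mem_domain hf hh hL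
  refine ⟨fun h hh => ⟨hs h hh, hd h hh⟩, ?_, ?_⟩
  · exact tendsto_supNorm_spectral hN hf hL
      (fun h hh => supNorm_berezin_normalToeplitz_le (hd h hh))
      fun h hh x => enorm_le_supNorm hN (berezin_scalarMatrix hf (hs h hh x))
  · exact tendsto_supNorm_spectral hN hf hL (fun h _ => opENorm_normalToeplitz_le h _)
      fun h hh x => enorm_scalarBerezin_le_opENorm hN hf (hs h hh x)
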